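/- **Setting.** Fix $n\ge 2$ and $\vec k=(k_1,\dots,k_m)$ with $1\le k_j\le n-1$ ($m=0$ allowed). A *(Fontaine) web graph* for $\mathfrak{sl}_n$ is a finite directed plane graph drawn below a horizontal axis (components that are closed loops without vertices are allowed), whose edges have weights in $\{1,\dots,n-1\}$, with univalent boundary vertices $v_1,\dots,v_m$ on the axis (read from left to right) and trivalent interior vertices, such that at each interior vertex the sum of the incoming weights minus the sum of the outgoing weights is $0$ mod $n$. It belongs to $F(\vec k)$ if for each $j$ the edge $e_j$ at $v_j$ either is directed into $v_j$ and has weight $k_j$, or is directed out of $v_j$ and has weight $n-k_j$. A *stranding* $S$ of $G$ is a collection of directed paths in $G$ (possibly running against edges), each closed or with both end points on the boundary and each with a colour in $\{1,\dots,n-1\}$, such that paths of the same colour are disjoint. For a directed edge $e$ put $\alpha_c(e)=1$, $-1$ or $0$ if a strand of colour $c$ runs along $e$ in its direction, runs along $e$ against its direction, or does not use $e$. The stranding is *valid* if on every edge $e$ there is a strand, the strands on $e$, ordered by colour, alternate in direction, and, with $\ell$ the weight of $e$ and $c_{\max}$ the largest colour on $e$, $\sum_c c\,\alpha_c(e)$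 equals $\ell$ if $\alpha_{c_{\max}}(e)=1$ and $\ell-n$ if $\alpha_{c_{\max}}(e)=-1$. Let $\mathrm{Str}(G)$ be the set of valid strandings. Let $\wedge_q$ be the product of the algebra over $\mathbb C(q)$ generated by $x_1,\dots,x_n$ with relations $x_i\wedge_q x_j+q\,x_j\wedge_q x_i=0$ for $i<j$ and $x_i\wedge_q x_i=0$. Let $V_k$ be the span of the $k$-fold products, with basis $x_T=x_{t_1}\wedge_q\cdots\wedge_q x_{t_k}$ for $T=\{t_1>\dots>t_k\}\subseteq\{1,\dots,n\}$; write $x_{\vec b}=x_T$ if $\vec b\in\{0,1\}^n$ has support $T$. Let $V(\vec k)=V_{k_1}\otimes\cdots\otimes V_{k_m}$, with its basis of monomials $x_{T_1}\otimes\cdots\otimes x_{T_m}$, $|T_j|=k_j$. For $S\in\mathrm{Str}(G)$ let $x_S=x_{\vec b_1}\otimes\cdots\otimes x_{\vec b_m}\in V(\vec k)$. Here, with $e_j$ redirected into $v_j$ (and its weight $\ell$ replaced by $n-\ell$) if necessary, $\vec b_j\in\{0,1\}^n$ has last entry $0$ if $\alpha_{c_{\max}}(e_j)=1$ and $1$ if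 $\alpha_{c_{\max}}(e_j)=-1$, and its entries in positions $c$ and $c+1$ differ by $\alpha_c(e_j)$: $(\vec b_j)_c-(\vec b_j)_{c+1}=\alpha_c(e_j)$. For $1\le i<j\le n$ let $L_{(i,j)}(S)$ be the directed graph of those edges $e$, with the direction for which $\sum_{c=i}^{j-1}\alpha_c(e)=1$; it is a disjoint union of directed closed loops and directed paths with end points on the axis. A path is clockwise or counterclockwise according to the closed curve obtained by closing it up along the axis. Let $x(S)$ be the number of closed clockwise components and $y(S)$ the number of all counterclockwise components (closed or not), summed over all $1\le i<j\le n$. The *web vector* of $G$ is $$f(G)=\sum_{S\in\mathrm{Str}(G)}(-q)^{x(S)-y(S)}\,x_S\in V(\vec k).$$ Let $c_j\in\{0,\dots,n-1\}$ be the residue of $k_1+\cdots+k_j$ mod $n$ (so $c_0=0$), let $\vec\lambda_c\in\{0,1\}^n$ have ones exactly in the first $c$ positions, and let $x_{S_0}=x_{\vec b_1}\otimes\cdots\otimes x_{\vec b_m}$, where $\vec b_j=\vec\lambda_{c_j}-\vec\lambda_{c_{j-1}}$ if $c_{j-1}<c_j$ and $\vec b_j=\vec 1+\vec\lambda_{c_j}-\vec\lambda_{c_{j-1}}$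 if $c_j<c_{j-1}$. This monomial depends only on $n$ and $\vec k$. **Statement.** For every web graph $G\in F(\vec k)$, $f(G)\neq 0$. In particular, the coefficient of the basis monomial $x_{S_0}$ in $f(G)$ is nonzero. -/

import Mathlib

noncomputable section

namespace Webs

/-! ## Quantum exterior powers -/

/-- The base field `ℂ(q)`. -/
abbrev K : Type := RatFunc ℂ
/-- The indeterminate `q`. -/
def q : K := RatFunc.X

/-- The defining relations of the quantum wedge product:
`x_i ∧ x_j + q x_j ∧ x_i = 0` for `i < j`, and `x_i ∧ x_i = 0`. -/
inductive QWedgeRel (n : ℕ) : FreeAlgebra K (Fin n) → FreeAlgebra K (Fin n) → Prop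
  | anticomm (i j : Fin n) (h : i < j) :
      QWedgeRel n (FreeAlgebra.ι K i * FreeAlgebra.ι K j
        + q • (FreeAlgebra.ι K j * FreeAlgebra.ι K i)) 0
  | square (i : Fin n) : QWedgeRel n (FreeAlgebra.ι K i * FreeAlgebra.ι K i) 0

/-- The quantum exterior algebra of `ℂ(q)^n`; its product is the quantum wedge product. The basis
vectors `x_1, …, x_n` correspond to the indices `0, …, n - 1` in `Fin n`. -/
def QExterior (n : ℕ) : Type := RingQuot (QWedgeRel n)

instance (n : ℕ) : Ring (QExterior n) := inferInstanceAs (Ring (RingQuot (QWedgeRel n)))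

instance (n : ℕ) : Algebra K (QExterior n) :=
  inferInstanceAs (Algebra K (RingQuot (QWedgeRel n)))

/-- The quotient map from the free algebra. -/
def QExterior.mk (n : ℕ) : FreeAlgebra K (Fin n) →ₐ[K] QExterior n :=
  RingQuot.mkAlgHom K (QWedgeRel n)

theorem QExterior.mk_rel {n : ℕ} {a b : FreeAlgebra K (Fin n)} (h : QWedgeRel n a b) :
    QExterior.mk n a = QExterior.mk n b :=
  RingQuot.mkAlgHom_rel K h

/-- The standard basis vector `x_i`. -/
def gen {n : ℕ} (i : Fin n) : QExterior n :=
  QExterior.mk n (FreeAlgebra.ι K i)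

/-- `x_T = x_{t_1} ∧ ⋯ ∧ x_{t_k}` for `T = {t_1 > ⋯ > t_k}`. -/
def wedge {n : ℕ} (T : Finset (Fin n)) : QExterior n :=
  ((T.sort (· ≥ ·)).map gen).prod

/-- The fundamental representation `V_k`: the `k`-fold quantum wedge power of `ℂ(q)^n`. -/
def V (n k : ℕ) : Submodule K (QExterior n) :=
  Submodule.span K (Set.range fun t : Fin k → Fin n => (List.ofFn fun i => gen (t i)).prod)

theorem gen_mul_gen {n : ℕ} {i j : Fin n} (h : i < j) :
    gen i * gen j = (-q) • (gen j * gen i) := by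
  have := QExterior.mk_rel (QWedgeRel.anticomm i j h)
  simp only [map_add, map_mul, map_smul, map_zero] at this
  rw [neg_smul]
  exact eq_neg_of_add_eq_zero_left this

theorem gen_mul_self {n : ℕ} (i : Fin n) : gen i * gen i = 0 := by
  have := QExterior.mk_rel (QWedgeRel.square i)
  rwa [map_mul, map_zero] at this

theorem wedge_insert {n : ℕ} (i : Fin n) (T : Finset (Fin n)) (h : ∀ t ∈ T, t < i) :
    wedge (insert i T) = gen i * wedge T := by
  unfold wedge
  rw [Finset.sort_insert (r := (· ≥ ·)) (fun b hb => (h b hb).le) (fun hi => lt_irrefl _ (h i hi))]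
  simp

theorem gen_mul_wedge {n : ℕ} (T : Finset (Fin n)) (i : Fin n) :
    ∃ c : K, gen i * wedge T = c • wedge (insert i T) ∧ (i ∈ T → c = 0) := by
  induction T using Finset.induction_on_max with
  | empty => exact ⟨1, by rw [wedge_insert i ∅ (by simp), one_smul], by simp⟩
  | insert a T ha ih =>
    obtain ⟨c, hc, hc'⟩ := ih
    rcases lt_trichotomy i a with h | rfl | h
    · refine ⟨-q * c, ?_, ?_⟩
      · rw [wedge_insert a T ha, ← mul_assoc, gen_mul_gen h, smul_mul_assoc, mul_assoc, hc,
          Finset.insert_comm, wedge_insert a (insert i T), mul_smul_comm, smul_smul]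
        intro t ht
        rcases Finset.mem_insert.1 ht with rfl | ht
        · exact h
        · exact ha t ht
      · intro hi
        rw [hc' ((Finset.mem_insert.1 hi).resolve_left h.ne), mul_zero]
    · refine ⟨0, ?_, fun _ => rfl⟩
      rw [wedge_insert i T ha, ← mul_assoc, gen_mul_self, zero_mul, zero_smul]
    · refine ⟨1, ?_, ?_⟩
      · rw [one_smul, ← wedge_insert]
        intro t ht
        rcases Finset.mem_insert.1 ht with rfl | ht
        · exact h
        · exact (ha t ht).trans h
      · intro hi
        rcases Finset.mem_insert.1 hi with rfl | hi
        · exact absurd h (lt_irrefl _)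
        · exact absurd (h.trans (ha _ hi)) (lt_irrefl _)

theorem prod_gen_mem (n : ℕ) : ∀ (k : ℕ) (t : Fin k → Fin n), ∃ (c : K) (T : Finset (Fin n)),
    (List.ofFn fun i => gen (t i)).prod = c • wedge T ∧ (c ≠ 0 → T.card = k)
  | 0, t => ⟨1, ∅, by simp [wedge], by simp⟩
  | k + 1, t => by
    obtain ⟨c, T, h, hT⟩ := prod_gen_mem n k (fun i => t i.succ)
    obtain ⟨d, hd, hd'⟩ := gen_mul_wedge T (t 0)
    refine ⟨c * d, insert (t 0) T, ?_, ?_⟩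
    · rw [List.ofFn_succ, List.prod_cons, h, mul_smul_comm, hd, smul_smul]
    · intro hcd
      rw [Finset.card_insert_of_notMem (fun hi => hcd (by rw [hd' hi, mul_zero])),
        hT (left_ne_zero_of_mul hcd)]

theorem wedge_mem_V {n : ℕ} (T : Finset (Fin n)) : wedge T ∈ V n T.card := by
  apply Submodule.subset_span
  refine ⟨fun i => (T.sort (· ≥ ·)).get (i.cast (by simp)), ?_⟩
  change (List.ofFn _).prod = (List.map _ _).prod
  congr 1
  apply List.ext_get <;> simp

/-- The `k`-element subsets of `{1, …, n}`. -/
abbrev Idx (n k : ℕ) : Type := {T : Finset (Fin n) // T.card = k}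

/-- `x_T` as an element of `V_k`, where `|T| = k`. -/
def wedgeV {n k : ℕ} (T : Idx n k) : V n k := ⟨wedge T.1, by have h := wedge_mem_V T.1; rwa [T.2] at h⟩

/-- Auxiliary: left multiplication by `x_i`, written on a free module with basis all `T`. -/
def wedgeOp (n : ℕ) (i : Fin n) : Module.End K (Finset (Fin n) →₀ K) :=
  Finsupp.lsum K fun T =>
    if i ∈ T then 0 else (-q) ^ (T.filter (i < ·)).card • Finsupp.lsingle (insert i T)

theorem wedgeOp_single {n : ℕ} (i : Fin n) (T : Finset (Fin n)) (c : K) :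
    wedgeOp n i (Finsupp.single T c) =
      if i ∈ T then 0 else Finsupp.single (insert i T) ((-q) ^ (T.filter (i < ·)).card * c) := by
  unfold wedgeOp
  rw [Finsupp.lsum_single]
  split_ifs <;> simp

/-- Auxiliary: the quantum exterior algebra acts by these operators, so the `x_T` are linearly
independent. -/
def wedgeRep (n : ℕ) : QExterior n →ₐ[K] Module.End K (Finset (Fin n) →₀ K) :=
  RingQuot.liftAlgHom K ⟨FreeAlgebra.lift K (wedgeOp n), by
    rintro _ _ (⟨i, j, h⟩ | ⟨i⟩)
    · simp only [map_add, map_mul, map_smul, FreeAlgebra.lift_ι_apply, map_zero]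
      ext1 T
      ext1
      simp only [LinearMap.comp_apply, LinearMap.add_apply, LinearMap.smul_apply,
        Module.End.mul_apply, Finsupp.lsingle_apply, wedgeOp_single, LinearMap.zero_apply]
      by_cases hi : i ∈ T
      · by_cases hj : j ∈ T <;> simp [hi, hj, wedgeOp_single]
      by_cases hj : j ∈ T
      · simp [hi, hj, wedgeOp_single]
      rw [if_neg hi, if_neg hj, wedgeOp_single, wedgeOp_single,
        if_neg (by simp [hi, h.ne]), if_neg (by simp [hj, h.ne']),
        Finset.insert_comm, Finset.filter_insert, Finset.filter_insert, if_pos h,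
        if_neg h.not_gt, Finset.card_insert_of_notMem (by simp [hj]), Finsupp.smul_single,
        ← Finsupp.single_add, smul_eq_mul]
      refine Eq.trans (congrArg (Finsupp.single _) ?_) (Finsupp.single_zero _)
      ring
    · simp only [map_mul, FreeAlgebra.lift_ι_apply, map_zero]
      ext1 T
      ext1
      simp only [LinearMap.comp_apply, Module.End.mul_apply, Finsupp.lsingle_apply,
        wedgeOp_single, LinearMap.zero_apply]
      split_ifs <;> simp [wedgeOp_single]⟩

theorem wedgeRep_gen {n : ℕ} (i : Fin n) : wedgeRep n (gen i) = wedgeOp n i := by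
  exact (RingQuot.liftAlgHom_mkAlgHom_apply K _ _ _).trans (FreeAlgebra.lift_ι_apply _ _)

theorem wedgeRep_wedge {n : ℕ} (T : Finset (Fin n)) :
    wedgeRep n (wedge T) (Finsupp.single ∅ 1) = Finsupp.single T 1 := by
  induction T using Finset.induction_on_max with
  | empty => simp [wedge]
  | insert a T ha ih =>
    rw [wedge_insert a T ha, map_mul, Module.End.mul_apply, ih, wedgeRep_gen, wedgeOp_single,
      if_neg (fun h => lt_irrefl _ (ha a h)),
      Finset.filter_false_of_mem (fun t ht => (ha t ht).not_gt)]
    simp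

theorem wedgeV_linearIndependent (n k : ℕ) :
    LinearIndependent K (wedgeV : Idx n k → V n k) := by
  let φ : V n k →ₗ[K] (Finset (Fin n) →₀ K) :=
    (LinearMap.applyₗ (Finsupp.single ∅ (1 : K))) ∘ₗ (wedgeRep n).toLinearMap ∘ₗ (V n k).subtype
  apply LinearIndependent.of_comp φ
  have : (φ ∘ wedgeV : Idx n k → _) = (fun T => Finsupp.single T (1 : K)) ∘ Subtype.val := by
    funext T
    exact wedgeRep_wedge T.1
  rw [this]
  exact ((Finsupp.basisSingleOne (R := K) (ι := Finset (Fin n))).linearIndependent.comp _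
    Subtype.val_injective)

theorem wedgeV_span (n k : ℕ) :
    ⊤ ≤ Submodule.span K (Set.range (wedgeV : Idx n k → V n k)) := by
  rintro ⟨v, hv⟩ -
  induction hv using Submodule.span_induction with
  | mem x hx =>
    obtain ⟨t, rfl⟩ := hx
    obtain ⟨c, T, h, hT⟩ := prod_gen_mem n k t
    by_cases hc : c = 0
    · convert Submodule.zero_mem _
      rw [hc, zero_smul] at h
      exact Subtype.ext h
    · have := Submodule.smul_mem (Submodule.span K (Set.range (wedgeV : Idx n k → V n k))) c
        (Submodule.subset_span ⟨⟨T, hT hc⟩, rfl⟩)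
      convert this
      exact Subtype.ext h
  | zero => exact Submodule.zero_mem _
  | add x y hx hy h1 h2 => exact Submodule.add_mem _ h1 h2
  | smul a x hx h => exact Submodule.smul_mem _ a h

/-- The basis `{x_T : |T| = k}` of `V_k`. -/
def wedgeBasis (n k : ℕ) : Module.Basis (Idx n k) K (V n k) :=
  Module.Basis.mk (wedgeV_linearIndependent n k) (wedgeV_span n k)

theorem wedgeBasis_apply {n k : ℕ} (T : Idx n k) : wedgeBasis n k T = wedgeV T :=
  Module.Basis.mk_apply _ _ _

/-! ## Web graphs -/

/-- The plane; the first coordinate is horizontal, the second vertical.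
The boundary axis is the horizontal line of height `0`. -/
abbrev Plane : Type := ℝ × ℝ

/-- A directed straight piece, from its first point to its second point. -/
abbrev Arc : Type := Plane × Plane

/-- A (Fontaine) web graph for `sl_n` with `m` boundary vertices, drawn in the closed lower half
plane. As usual for plane graphs, an edge is a polygonal arc (or, for a loop without vertices, a
closed polygon): it is given by its straight pieces, all directed along the edge and carrying the
weight of the edge. So a point below the axis at which pieces meet is either an interior vertex
(three pieces) or a bend of an edge (one piece ends there, one starts, and the weights agree).
Values of `wt` outside `seg` are irrelevant. -/
structure FontaineWeb (n m : ℕ) where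
  /-- the directed straight pieces of the edges -/
  seg : Finset Arc
  /-- the weight of the edge to which a piece belongs -/
  wt : Arc → ℕ
  /-- the horizontal coordinates of the boundary vertices, from left to right -/
  bx : Fin m → ℝ
  bx_strictMono : StrictMono bx
  seg_ne : ∀ s ∈ seg, s.1 ≠ s.2
  /-- the drawing lies below the axis and touches it only in end points of pieces -/
  seg_below : ∀ s ∈ seg, s.1.2 ≤ 0 ∧ s.2.2 ≤ 0 ∧ ¬(s.1.2 = 0 ∧ s.2.2 = 0)
  /-- distinct pieces meet at most in common end points -/
  planar : ∀ s ∈ seg, ∀ t ∈ seg, s ≠ t →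
    segment ℝ s.1 s.2 ∩ segment ℝ t.1 t.2 ⊆ {s.1, s.2} ∩ {t.1, t.2}
  wt_mem : ∀ s ∈ seg, 1 ≤ wt s ∧ wt s ≤ n - 1
  /-- the points of the drawing on the axis are boundary vertices -/
  axis : ∀ s ∈ seg, ∀ p : Plane, p = s.1 ∨ p = s.2 → p.2 = 0 → ∃ j, p = (bx j, 0)
  /-- boundary vertices are univalent -/
  univalent : ∀ j, (seg.filter fun s => s.2 = (bx j, 0)).card
    + (seg.filter fun s => s.1 = (bx j, 0)).card = 1
  /-- a point below the axis is off the graph (or in the relative interior of a piece), or an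
  interior vertex, or a bend. Interior vertices are trivalent with conservation of flow
  modulo `n`. -/
  interior : ∀ p : Plane, p.2 < 0 →
    (∀ s ∈ seg, s.1 ≠ p ∧ s.2 ≠ p) ∨
    ((seg.filter fun s => s.2 = p).card + (seg.filter fun s => s.1 = p).card = 3 ∧
      (n : ℤ) ∣ (∑ s ∈ seg with s.2 = p, (wt s : ℤ)) - ∑ s ∈ seg with s.1 = p, (wt s : ℤ)) ∨
    ((seg.filter fun s => s.2 = p).card = 1 ∧ (seg.filter fun s => s.1 = p).card = 1 ∧
      ∑ s ∈ seg with s.2 = p, wt s = ∑ s ∈ seg with s.1 = p, wt s)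

namespace FontaineWeb

variable {n m : ℕ}

/-- The boundary vertices `v_1, …, v_m` from left to right. -/
def bdry (G : FontaineWeb n m) (j : Fin m) : Plane := (G.bx j, 0)

/-- The boundary weight vector: `k_j` is `ℓ` if the (unique) edge at the `j`-th boundary vertex is
directed into it and has weight `ℓ`, and `n - ℓ` if that edge is directed out of it. -/
def boundaryWeight (G : FontaineWeb n m) (j : Fin m) : ℕ :=
  (∑ s ∈ G.seg with s.2 = G.bdry j, G.wt s) + ∑ s ∈ G.seg with s.1 = G.bdry j, (n - G.wt s)

/-- The pieces of the graph, each with both of its directions. -/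
def arcs (G : FontaineWeb n m) : Finset Arc := G.seg ∪ G.seg.image Prod.swap

theorem exists_bdryArc (G : FontaineWeb n m) (j : Fin m) :
    ∃ a : Arc, a.2 = G.bdry j ∧
      ((a ∈ G.seg ∧ G.boundaryWeight j = G.wt a) ∨
        (a.swap ∈ G.seg ∧ G.boundaryWeight j = n - G.wt a.swap)) := by
  have h := G.univalent j
  change (G.seg.filter fun s => s.2 = G.bdry j).card
    + (G.seg.filter fun s => s.1 = G.bdry j).card = 1 at h
  unfold boundaryWeight
  rcases Nat.add_eq_one_iff.1 h with ⟨h1, h2⟩ | ⟨h1, h2⟩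
  · obtain ⟨s, hs⟩ := Finset.card_eq_one.1 h2
    have hm : s ∈ G.seg.filter fun s => s.1 = G.bdry j := by rw [hs]; simp
    rw [Finset.mem_filter] at hm
    exact ⟨s.swap, hm.2, Or.inr ⟨hm.1, by rw [Finset.card_eq_zero.1 h1, hs]; simp⟩⟩
  · obtain ⟨s, hs⟩ := Finset.card_eq_one.1 h1
    have hm : s ∈ G.seg.filter fun s => s.2 = G.bdry j := by rw [hs]; simp
    rw [Finset.mem_filter] at hm
    exact ⟨s, hm.2, Or.inl ⟨hm.1, by rw [Finset.card_eq_zero.1 h2, hs]; simp⟩⟩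

/-- The piece at the `j`-th boundary vertex, directed into that vertex (so possibly flipped). -/
def bdryArc (G : FontaineWeb n m) (j : Fin m) : Arc := (G.exists_bdryArc j).choose

end FontaineWeb

/-- `F(k)`: the web graphs with boundary weight vector `k`. -/
def F (n : ℕ) {m : ℕ} (k : Fin m → ℕ) : Set (FontaineWeb n m) := {G | G.boundaryWeight = k}

/-! ## Strandings -/

/-- A directed path is recorded by the set `P` of directed pieces it runs along.
`P` is a strand if it is a directed path of the graph (visiting no point twice and possibly running
against the direction of edges) which joins two points of the axis or is closed. -/
def IsStrand {n m : ℕ} (G : FontaineWeb n m) (P : Finset Arc) : Prop :=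
  P ⊆ G.arcs ∧ ∃ l : List Plane, l.Nodup ∧
    ((2 ≤ l.length ∧ (∀ p ∈ l.head?, p.2 = 0) ∧ (∀ p ∈ l.getLast?, p.2 = 0) ∧
        P = (l.zip l.tail).toFinset) ∨
      (3 ≤ l.length ∧ P = (l.zip (l.rotate 1)).toFinset))

/-- The points (vertices and bends) that a path visits. -/
def points (P : Finset Arc) : Finset Plane := P.image Prod.fst ∪ P.image Prod.snd

/-- A stranding is a collection of directed paths, each with a colour. -/
def IsStranding {n m : ℕ} (G : FontaineWeb n m) (S : Finset (ℕ × Finset Arc)) : Prop :=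
  (∀ s ∈ S, 1 ≤ s.1 ∧ s.1 ≤ n - 1 ∧ IsStrand G s.2) ∧
    ∀ s ∈ S, ∀ t ∈ S, s ≠ t → s.1 = t.1 → Disjoint (points s.2) (points t.2)

open Classical in
/-- `α^∨_c(e)` for the directed piece `e`: `1` if a strand of colour `c` runs along `e` in its
direction, `-1` if one runs along `e` in the opposite direction, and `0` otherwise. -/
def coroot (S : Finset (ℕ × Finset Arc)) (e : Arc) (c : ℕ) : ℤ :=
  if ∃ P, (c, P) ∈ S ∧ e ∈ P then 1
  else if ∃ P, (c, P) ∈ S ∧ e.swap ∈ P then -1 else 0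

/-- Validity on an edge of weight `ℓ` on which the strands are described by `a c = α^∨_c(e)`:
strands ordered by colour alternate in direction, and the signed sum of the colours is `ℓ` or
`ℓ - n` according to the direction of the strand of largest colour. -/
def ValidOn (n ℓ : ℕ) (a : ℕ → ℤ) : Prop :=
  (∀ c d, c < d → a c ≠ 0 → a d ≠ 0 → (∀ b, c < b → b < d → a b = 0) → a c * a d = -1) ∧
    ∃ cmax, IsGreatest {c | a c ≠ 0} cmax ∧
      ∑ c ∈ Finset.Icc 1 (n - 1), a c * (c : ℤ) =
        if a cmax = 1 then (ℓ : ℤ) else (ℓ : ℤ) - (n : ℤ)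

open Classical in
/-- `Str(G)`: the finite set of valid strandings of `G`. -/
def strandings {n m : ℕ} (G : FontaineWeb n m) : Finset (Finset (ℕ × Finset Arc)) :=
  (Finset.Icc 1 (n - 1) ×ˢ G.arcs.powerset).powerset.filter fun S =>
    IsStranding G S ∧ ∀ e ∈ G.seg, ValidOn n (G.wt e) (coroot S e)

open Classical in
theorem mem_strandings {n m : ℕ} {G : FontaineWeb n m} {S : Finset (ℕ × Finset Arc)} :
    S ∈ strandings G ↔ IsStranding G S ∧ ∀ e ∈ G.seg, ValidOn n (G.wt e) (coroot S e) := by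
  unfold strandings
  rw [Finset.mem_filter, Finset.mem_powerset, and_iff_right_iff_imp]
  intro h s hs
  have := h.1.1 s hs
  exact Finset.mem_product.2 ⟨Finset.mem_Icc.2 ⟨this.1, this.2.1⟩,
    Finset.mem_powerset.2 this.2.2.1⟩

open Classical in
/-- The binary vector `b_S(e)`, as a function of `a c = α^∨_c(e)`. The entry in position `n` is `0`
or `1` according to the direction of the strand of largest colour, and the entries in positions `c`
and `c + 1` differ by `a c`. Positions `1, …, n` correspond to `0, …, n - 1` in `Fin n`. -/
def binaryLabel (n : ℕ) (a : ℕ → ℤ) (i : Fin n) : ℤ :=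
  (if ∃ cmax, IsGreatest {c | a c ≠ 0} cmax ∧ a cmax = -1 then 1 else 0)
    + ∑ c ∈ Finset.Icc (i.val + 1) (n - 1), a c

/-- `T(b) = {i | b_i ≠ 0}`. -/
def support {n : ℕ} (b : Fin n → ℤ) : Finset (Fin n) := Finset.univ.filter fun i => b i ≠ 0

section labels

variable {n : ℕ} {a : ℕ → ℤ}

theorem ValidOn.tail_sum {ℓ : ℕ} (h : ValidOn n ℓ a) (h1 : ∀ c, a c = 0 ∨ a c = 1 ∨ a c = -1)
    (h0 : ∀ c, n - 1 < c → a c = 0) {cmax : ℕ} (hm : IsGreatest {c | a c ≠ 0} cmax) (d : ℕ) :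
    ∀ i, i + d = n → (∑ c ∈ Finset.Icc (i + 1) (n - 1), a c = 0 ∧
        ((∀ c, i < c → a c = 0) ∨ ∃ c, i < c ∧ a c = -a cmax ∧ ∀ b, i < b → b < c → a b = 0)) ∨
      (∑ c ∈ Finset.Icc (i + 1) (n - 1), a c = a cmax ∧
        ∃ c, i < c ∧ a c = a cmax ∧ ∀ b, i < b → b < c → a b = 0) := by
  induction d with
  | zero =>
    intro i hi
    left
    refine ⟨Finset.sum_eq_zero fun c hc => ?_, Or.inl fun c hc => h0 c (by omega)⟩
    have := Finset.mem_Icc.1 hc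
    omega
  | succ d ih =>
    intro i hi
    have ih := ih (i + 1) (by omega)
    have hs : ∑ c ∈ Finset.Icc (i + 1) (n - 1), a c
        = a (i + 1) + ∑ c ∈ Finset.Icc (i + 1 + 1) (n - 1), a c := by
      by_cases hin : i + 1 ≤ n - 1
      · rw [← Finset.insert_Icc_add_one_left_eq_Icc hin, Finset.sum_insert (by simp)]
      · rw [Finset.Icc_eq_empty hin, Finset.Icc_eq_empty (by omega), h0 _ (by omega)]
        simp
    rw [hs]
    have hmax := h1 cmax
    have hmax0 : a cmax ≠ 0 := hm.1
    by_cases hz : a (i + 1) = 0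
    · have key : ∀ c, i + 1 < c → (∀ b, i + 1 < b → b < c → a b = 0) →
          ∀ b, i < b → b < c → a b = 0 := by
        intro c hc hb b hib hbc
        rcases Nat.lt_or_ge (i + 1) b with hlt | hle
        · exact hb b hlt hbc
        · rwa [show b = i + 1 by omega]
      rw [hz, zero_add]
      rcases ih with ⟨hS, hA | ⟨c, hc, hac, hb⟩⟩ | ⟨hS, c, hc, hac, hb⟩
      · refine Or.inl ⟨hS, Or.inl fun c hc => ?_⟩
        rcases Nat.lt_or_ge (i + 1) c with hlt | hle
        · exact hA c hlt
        · rwa [show c = i + 1 by omega]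
      · exact Or.inl ⟨hS, Or.inr ⟨c, by omega, hac, key c hc hb⟩⟩
      · exact Or.inr ⟨hS, c, by omega, hac, key c hc hb⟩
    · have nob : ∀ b, i < b → b < i + 1 → a b = 0 := by intro b h1 h2; omega
      rcases ih with ⟨hS, hA | ⟨c, hc, hac, hb⟩⟩ | ⟨hS, c, hc, hac, hb⟩
      · have : cmax = i + 1 := by
          apply le_antisymm
          · by_contra hlt
            exact hmax0 (hA cmax (by omega))
          · exact hm.2 hz
        exact Or.inr ⟨by rw [hS, this, add_zero], i + 1, by omega, by rw [this], nob⟩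
      · have hp := h.1 (i + 1) c hc hz (by rw [hac]; exact neg_ne_zero.2 hmax0) hb
        have : a (i + 1) = a cmax := by
          rw [hac] at hp
          rcases hmax with h3 | h3 | h3
          · exact absurd h3 hmax0
          all_goals rw [h3] at hp ⊢; linarith
        exact Or.inr ⟨by rw [hS, this, add_zero], i + 1, by omega, this, nob⟩
      · have hp := h.1 (i + 1) c hc hz (by rw [hac]; exact hmax0) hb
        have : a (i + 1) = -a cmax := by
          rw [hac] at hp
          rcases hmax with h3 | h3 | h3
          · exact absurd h3 hmax0
          all_goals rw [h3] at hp ⊢; linarith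
        exact Or.inl ⟨by rw [hS, this, neg_add_cancel], Or.inr ⟨i + 1, by omega, this, nob⟩⟩

theorem sum_tail (n : ℕ) (a : ℕ → ℤ) :
    ∑ i : Fin n, ∑ c ∈ Finset.Icc (i.val + 1) (n - 1), a c
      = ∑ c ∈ Finset.Icc 1 (n - 1), a c * (c : ℤ) := by
  rw [Fin.sum_univ_eq_sum_range (fun i => ∑ c ∈ Finset.Icc (i + 1) (n - 1), a c) n,
    Finset.sum_comm' (t' := Finset.Icc 1 (n - 1)) (s' := fun c => Finset.range c)]
  · refine Finset.sum_congr rfl fun c _ => ?_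
    rw [Finset.sum_const, Finset.card_range, nsmul_eq_mul, mul_comm]
  · intro i c
    simp only [Finset.mem_range, Finset.mem_Icc]
    omega

/-- The binary vector of an edge of weight `ℓ` has exactly `ℓ` nonzero entries. -/
theorem ValidOn.card_support {ℓ : ℕ} (h : ValidOn n ℓ a)
    (h1 : ∀ c, a c = 0 ∨ a c = 1 ∨ a c = -1) (h0 : ∀ c, n - 1 < c → a c = 0) :
    (support (binaryLabel n a)).card = ℓ := by
  obtain ⟨cmax, hm, hsum⟩ := h.2
  have hmax0 : a cmax ≠ 0 := hm.1
  have hb : ∀ i : Fin n, binaryLabel n a i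
      = (if a cmax = -1 then 1 else 0) + ∑ c ∈ Finset.Icc (i.val + 1) (n - 1), a c := by
    intro i
    have hiff : (∃ c, IsGreatest {c | a c ≠ 0} c ∧ a c = -1) ↔ a cmax = -1 := by
      refine ⟨?_, fun hc => ⟨cmax, hm, hc⟩⟩
      rintro ⟨c, hc, hc'⟩
      rwa [← hc.unique hm]
    unfold binaryLabel
    simp only [hiff]
  have h01 : ∀ i : Fin n, binaryLabel n a i = 0 ∨ binaryLabel n a i = 1 := by
    intro i
    rw [hb]
    rcases h.tail_sum h1 h0 hm (n - i) i (by omega) with ⟨h2, -⟩ | ⟨h2, -⟩ <;>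
      rcases h1 cmax with h3 | h3 | h3 <;> simp_all
  have hcard : ((support (binaryLabel n a)).card : ℤ) = ∑ i : Fin n, binaryLabel n a i := by
    unfold support
    rw [Finset.card_filter]
    push_cast
    refine Finset.sum_congr rfl fun i _ => ?_
    rcases h01 i with h2 | h2 <;> simp [h2]
  simp only [hb, Finset.sum_add_distrib, sum_tail, hsum] at hcard
  rw [Finset.sum_const, Finset.card_univ, Fintype.card_fin] at hcard
  rcases h1 cmax with h3 | h3 | h3
  · exact absurd h3 hmax0
  · simp [h3] at hcard; exact_mod_cast hcard
  · simp [h3] at hcard; exact_mod_cast hcard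

/-- Reversing an edge of weight `ℓ` gives an edge of weight `n - ℓ` with the same strands. -/
theorem ValidOn.neg {ℓ : ℕ} (hn : ℓ ≤ n) (h : ValidOn n ℓ a)
    (h1 : ∀ c, a c = 0 ∨ a c = 1 ∨ a c = -1) : ValidOn n (n - ℓ) (fun c => -a c) := by
  refine ⟨fun c d hcd hc hd hb => ?_, ?_⟩
  · rw [neg_mul_neg]
    exact h.1 c d hcd (by simpa using hc) (by simpa using hd) fun b h2 h3 => by
      simpa using hb b h2 h3
  · obtain ⟨cmax, hm, hsum⟩ := h.2
    have hmax0 : a cmax ≠ 0 := hm.1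
    refine ⟨cmax, by simpa using hm, ?_⟩
    simp only [neg_mul, Finset.sum_neg_distrib, hsum]
    rcases h1 cmax with h3 | h3 | h3
    · exact absurd h3 hmax0
    · simp [h3, Nat.cast_sub hn]
    · simp [h3, Nat.cast_sub hn]

end labels

theorem coroot_mem (S : Finset (ℕ × Finset Arc)) (e : Arc) (c : ℕ) :
    coroot S e c = 0 ∨ coroot S e c = 1 ∨ coroot S e c = -1 := by
  unfold coroot
  split_ifs <;> simp

theorem coroot_eq_zero {n m : ℕ} {G : FontaineWeb n m} {S : Finset (ℕ × Finset Arc)}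
    (hS : IsStranding G S) (e : Arc) (c : ℕ) (hc : n - 1 < c) : coroot S e c = 0 := by
  unfold coroot
  rw [if_neg, if_neg]
  · rintro ⟨P, hP, -⟩
    have := (hS.1 _ hP).2.1
    simp only at this
    omega
  · rintro ⟨P, hP, -⟩
    have := (hS.1 _ hP).2.1
    simp only at this
    omega

/-- A strand does not run along a piece in both directions. -/
theorem IsStrand.not_swap_mem {n m : ℕ} {G : FontaineWeb n m} {P : Finset Arc}
    (h : IsStrand G P) {e : Arc} (he : e ∈ P) : e.swap ∉ P := by
  intro hs
  obtain ⟨-, l, hl, ⟨-, -, -, rfl⟩ | ⟨h3, rfl⟩⟩ := h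
  · rw [List.mem_toFinset, List.mem_iff_getElem] at he hs
    obtain ⟨i, hi, rfl⟩ := he
    obtain ⟨j, hj, hij⟩ := hs
    simp only [List.length_zip, List.length_tail, lt_min_iff] at hi hj
    simp only [List.getElem_zip, List.getElem_tail, Prod.swap_prod_mk, Prod.mk.injEq,
      hl.getElem_inj_iff] at hij
    omega
  · rw [List.mem_toFinset, List.mem_iff_getElem] at he hs
    obtain ⟨i, hi, rfl⟩ := he
    obtain ⟨j, hj, hij⟩ := hs
    simp only [List.length_zip, List.length_rotate, lt_min_iff] at hi hj
    simp only [List.getElem_zip, List.getElem_rotate, Prod.swap_prod_mk, Prod.mk.injEq,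
      hl.getElem_inj_iff] at hij
    obtain ⟨h4, h5⟩ := hij
    rcases Nat.lt_or_ge (i + 1) l.length with h6 | h6
    · rw [Nat.mod_eq_of_lt h6] at h4
      rcases Nat.lt_or_ge (j + 1) l.length with h7 | h7
      · rw [Nat.mod_eq_of_lt h7] at h5; omega
      · rw [show j + 1 = l.length by omega, Nat.mod_self] at h5; omega
    · rw [show i + 1 = l.length by omega, Nat.mod_self] at h4
      subst h4
      rw [Nat.mod_eq_of_lt (by omega)] at h5
      omega

/-- In a stranding at most one strand of each colour runs along a piece. -/
theorem coroot_swap {n m : ℕ} {G : FontaineWeb n m} {S : Finset (ℕ × Finset Arc)}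
    (hS : IsStranding G S) (e : Arc) (c : ℕ) : coroot S e.swap c = -coroot S e c := by
  have key : ¬ ((∃ P, (c, P) ∈ S ∧ e ∈ P) ∧ ∃ P, (c, P) ∈ S ∧ e.swap ∈ P) := by
    rintro ⟨⟨P, hP, heP⟩, Q, hQ, heQ⟩
    by_cases hPQ : P = Q
    · subst hPQ
      exact (hS.1 _ hP).2.2.not_swap_mem heP heQ
    · have := hS.2 _ hP _ hQ (fun h => hPQ (congrArg Prod.snd h)) rfl
      exact Finset.disjoint_left.1 this
        (Finset.mem_union_left _ (Finset.mem_image_of_mem Prod.fst heP))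
        (Finset.mem_union_right _ (Finset.mem_image.2 ⟨e.swap, heQ, rfl⟩))
  unfold coroot
  rw [Prod.swap_swap]
  by_cases h1 : ∃ P, (c, P) ∈ S ∧ e ∈ P
  · have h2 : ¬∃ P, (c, P) ∈ S ∧ e.swap ∈ P := fun h => key ⟨h1, h⟩
    rw [if_neg h2, if_pos h1, if_pos h1]
  · rw [if_neg h1, if_neg h1]
    split_ifs <;> simp

/-! ## Web vectors -/

/-- The binary vector `b̂(e_j)` of a stranding at the `j`-th boundary vertex: the one of the boundary
edge, flipped if necessary so that it is directed into the boundary. -/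
def bdryLabel {n m : ℕ} (G : FontaineWeb n m) (S : Finset (ℕ × Finset Arc)) (j : Fin m) :
    Fin n → ℤ :=
  binaryLabel n (coroot S (G.bdryArc j))

theorem card_support_bdryLabel {n m : ℕ} {G : FontaineWeb n m} {S : Finset (ℕ × Finset Arc)}
    (hS : S ∈ strandings G) (j : Fin m) :
    (support (bdryLabel G S j)).card = G.boundaryWeight j := by
  rw [mem_strandings] at hS
  obtain ⟨hS, hv⟩ := hS
  obtain ⟨-, ⟨hm, hw⟩ | ⟨hm, hw⟩⟩ := (G.exists_bdryArc j).choose_spec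
  · rw [hw]
    exact (hv _ hm).card_support (coroot_mem _ _) (coroot_eq_zero hS _)
  · rw [hw]
    have hle := (G.wt_mem _ hm).2
    have := (hv _ hm).neg (by omega) (coroot_mem _ _)
    simp only [← coroot_swap hS, Prod.swap_swap] at this
    exact this.card_support (coroot_mem _ _) (coroot_eq_zero hS _)

open TensorProduct in
/-- `V(k) = V_{k_1} ⊗ ⋯ ⊗ V_{k_m}`. -/
abbrev VTensor (n : ℕ) {m : ℕ} (k : Fin m → ℕ) : Type := ⨂[K] j, V n (k j)

/-- The basis of `V(k)` consisting of the monomials `x_{T_1} ⊗ ⋯ ⊗ x_{T_m}` with `|T_j| = k_j`. -/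
def monomialBasis (n : ℕ) {m : ℕ} (k : Fin m → ℕ) :
    Module.Basis ((j : Fin m) → Idx n (k j)) K (VTensor n k) :=
  Basis.piTensorProduct fun j => wedgeBasis n (k j)

theorem monomialBasis_apply (n : ℕ) {m : ℕ} (k : Fin m → ℕ) (T : (j : Fin m) → Idx n (k j)) :
    monomialBasis n k T = PiTensorProduct.tprod K fun j => wedgeV (T j) := by
  unfold monomialBasis
  rw [Basis.piTensorProduct_apply]
  simp only [wedgeBasis_apply]

/-- The sets `T_1, …, T_m` of the monomial `x_S` of a valid stranding `S`. -/
def strandingIdx {n m : ℕ} {k : Fin m → ℕ} (G : F n k) (S : strandings G.1) :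
    (j : Fin m) → Idx n (k j) :=
  fun j => ⟨support (bdryLabel G.1 S.1 j), by
    rw [card_support_bdryLabel S.2 j]; exact congrFun G.2 j⟩

/-- The monomial `x_S`. -/
def strandingMonomial {n m : ℕ} {k : Fin m → ℕ} (G : F n k) (S : strandings G.1) : VTensor n k :=
  PiTensorProduct.tprod K fun j => wedgeV (strandingIdx G S j)

/-- The directed pieces of the flow graph `L_{(i,j)}(S)`: those directed so that
`∑_{i ≤ c < j} α^∨_c` is `1`. -/
def flowArcs {n m : ℕ} (G : FontaineWeb n m) (S : Finset (ℕ × Finset Arc)) (i j : ℕ) :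
    Finset Arc :=
  G.arcs.filter fun e => ∑ c ∈ Finset.Ico i j, coroot S e c = 1

open Classical in
/-- The connected components of the directed graph with arcs `L`, each given by its set of arcs
(isolated points are not counted). -/
def components (L : Finset Arc) : Finset (Finset Arc) :=
  L.image fun e => L.filter fun d =>
    (SimpleGraph.fromRel fun p r => (p, r) ∈ L).Reachable e.1 d.1

/-- Twice the signed area enclosed by a directed closed polygon. A directed path that joins two
points of the axis is closed up along the axis, which contributes `0`. A simple closed polygon, and
a simple path below the axis so closed up, is counterclockwise if this is positive and clockwise if
it is negative. -/
def signedArea (C : Finset Arc) : ℝ := ∑ e ∈ C, (e.1.1 * e.2.2 - e.2.1 * e.1.2)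

/-- `C` does not touch the boundary. -/
def IsClosedComp (C : Finset Arc) : Prop := ∀ e ∈ C, e.1.2 ≠ 0 ∧ e.2.2 ≠ 0

open Classical in
/-- `x(S)`: the number of closed clockwise components, over all flows `1 ≤ i < j ≤ n`. -/
def xStat {n m : ℕ} (G : FontaineWeb n m) (S : Finset (ℕ × Finset Arc)) : ℕ :=
  ∑ i ∈ Finset.Icc 1 n, ∑ j ∈ Finset.Ioc i n,
    ((components (flowArcs G S i j)).filter fun C => IsClosedComp C ∧ signedArea C < 0).card

/-- `y(S)`: the number of counterclockwise components, closed or not, over all flows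
`1 ≤ i < j ≤ n`. -/
def yStat {n m : ℕ} (G : FontaineWeb n m) (S : Finset (ℕ × Finset Arc)) : ℕ :=
  ∑ i ∈ Finset.Icc 1 n, ∑ j ∈ Finset.Ioc i n,
    ((components (flowArcs G S i j)).filter fun C => 0 < signedArea C).card

/-- The web vector `f(G) = ∑_S (-q)^{x(S) - y(S)} x_S`. -/
def webVector {n m : ℕ} {k : Fin m → ℕ} (G : F n k) : VTensor n k :=
  ∑ S : strandings G.1, (-q) ^ ((xStat G.1 S.1 : ℤ) - (yStat G.1 S.1 : ℤ)) • strandingMonomial G S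

/-! ## The base monomial -/

/-- `c_j`: the residue modulo `n`, in `0, …, n - 1`, of `k_1 + ⋯ + k_j`. -/
def partialSum (n : ℕ) {m : ℕ} (k : Fin m → ℕ) (j : ℕ) : ℕ :=
  (∑ t : Fin m with t.val < j, k t) % n

/-- `λ_c`: the vector with `1` in the first `c` positions and `0` in the others. -/
def fundWeight (n c : ℕ) (i : Fin n) : ℤ := if i.val < c then 1 else 0

/-- The `j`-th binary vector of the base monomial: `λ_{c_j} - λ_{c_{j-1}}` if `c_{j-1} < c_j`, and
`1 + λ_{c_j} - λ_{c_{j-1}}` otherwise. Here `j.val` and `j.val + 1` stand for `j - 1` and `j`, as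
`Fin m` starts at `0`. -/
def baseLabel (n : ℕ) {m : ℕ} (k : Fin m → ℕ) (j : Fin m) (i : Fin n) : ℤ :=
  if partialSum n k j.val < partialSum n k (j.val + 1) then
    fundWeight n (partialSum n k (j.val + 1)) i - fundWeight n (partialSum n k j.val) i
  else
    1 + fundWeight n (partialSum n k (j.val + 1)) i - fundWeight n (partialSum n k j.val) i

theorem sum_fundWeight {n c : ℕ} (h : c ≤ n) : ∑ i : Fin n, fundWeight n c i = (c : ℤ) := by
  unfold fundWeight
  rw [Finset.sum_boole, Fin.card_filter_val_lt, min_eq_right h]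

theorem card_support_baseLabel {n m : ℕ} {k : Fin m → ℕ} (hk : ∀ j, 1 ≤ k j ∧ k j ≤ n - 1)
    (j : Fin m) : (support (baseLabel n k j)).card = k j := by
  have hkj := hk j
  have hn : 0 < n := by omega
  have hc : partialSum n k (j.val + 1) = (partialSum n k j.val + k j) % n := by
    unfold partialSum
    rw [Nat.mod_add_mod]
    congr 1
    rw [show (Finset.univ.filter fun t : Fin m => t.val < j.val + 1)
        = insert j (Finset.univ.filter fun t : Fin m => t.val < j.val) by
      ext t
      simp only [Finset.mem_filter, Finset.mem_univ, true_and, Finset.mem_insert, Fin.ext_iff]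
      omega, Finset.sum_insert (by simp), add_comm]
  have h1 : partialSum n k j.val < n := Nat.mod_lt _ hn
  have h01 : ∀ i, baseLabel n k j i = 0 ∨ baseLabel n k j i = 1 := by
    intro i
    unfold baseLabel fundWeight
    split_ifs <;> omega
  have hcard : ((support (baseLabel n k j)).card : ℤ) = ∑ i : Fin n, baseLabel n k j i := by
    unfold support
    rw [Finset.card_filter]
    push_cast
    refine Finset.sum_congr rfl fun i _ => ?_
    rcases h01 i with h2 | h2 <;> simp [h2]
  have h2 : partialSum n k (j.val + 1) < n := Nat.mod_lt _ hn
  have hsum : ∑ i : Fin n, baseLabel n k j i = (k j : ℤ) := by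
    unfold baseLabel
    rcases Nat.lt_or_ge (partialSum n k j.val + k j) n with h | h
    · rw [Nat.mod_eq_of_lt h] at hc
      simp only [if_pos (show partialSum n k j.val < partialSum n k (j.val + 1) by omega),
        Finset.sum_sub_distrib, sum_fundWeight h1.le, sum_fundWeight h2.le]
      omega
    · rw [Nat.mod_eq_sub_mod h, Nat.mod_eq_of_lt (by omega)] at hc
      simp only [if_neg (show ¬ partialSum n k j.val < partialSum n k (j.val + 1) by omega),
        Finset.sum_sub_distrib, Finset.sum_add_distrib, sum_fundWeight h1.le,
        sum_fundWeight h2.le, Finset.sum_const, Finset.card_univ, Fintype.card_fin,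
        nsmul_eq_mul, mul_one]
      omega
  omega

/-- The sets `T_1, …, T_m` of the base monomial `x_{S_0}`; they depend only on `n` and `k`. -/
def baseIdx (n : ℕ) {m : ℕ} (k : Fin m → ℕ) (hk : ∀ j, 1 ≤ k j ∧ k j ≤ n - 1) :
    (j : Fin m) → Idx n (k j) :=
  fun j => ⟨support (baseLabel n k j), card_support_baseLabel hk j⟩

end Webs
end

noncomputable section

namespace Webs

/-! The coefficient of a monomial in the web vector is a sum of powers of `-q`, each with
coefficient one. At `q = -1` such a sum becomes the number of its terms, so nothing can cancel
(`sum_neg_q_zpow_ne_zero`). It therefore suffices to find one valid stranding whose monomial is the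
base monomial (`exists_stranding_baseLabel`).

That stranding comes from labelling faces. The weights form a flow modulo `n` that is conserved
below the axis, so the faces of the plane graph can be labelled by residues in such a way that,
across every edge, the right label minus the left label is the weight. For each `c` from `1` to `n -
1`, the strands of colour `c` are the boundary curves of the region labelled `c`, directed with that
region on their right. An edge with right label `r` and left label `l` then carries colour `r`
forwards and colour `l` backwards, the label `0` giving no strand. As `r - l` is `ℓ` or `ℓ - n`
according to which label is larger, this is exactly validity (`validOn_edgeCoroot`). Along the axis
the label grows by `k_j` at `v_j`, so the labels there are the partial sums `c_j` and the boundary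
vectors are those of the base monomial.

No topology of faces is used. After a shear that separates the end points, a label is minus the
total flow through a downward ray. The label below an arc is the same at both of its ends
(`lowerLabel_eq`), and the labels match up around every point below the axis (`sum_label_eq`). Hence
the arcs of one colour are balanced there. Since interior vertices are trivalent and the two sides
of an edge have different labels, a colour passes at most once through each point (`isPathSystem`),
so its arcs split into disjoint paths and cycles (`exists_decomposition`). -/

/-! ## Face labels of a flow on a plane graph -/

/-- The horizontal coordinate after a shear of the plane along the axis. -/
def shear (ε : ℝ) (p : Plane) : ℝ := p.1 + ε * p.2

/-- The slope of an arc in the sheared coordinates. -/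
def slope (ε : ℝ) (a : Arc) : ℝ := (a.2.2 - a.1.2) / (shear ε a.2 - shear ε a.1)

/-- The height of an arc over the sheared coordinate `t`. -/
def height (ε : ℝ) (a : Arc) (t : ℝ) : ℝ := a.1.2 + (t - shear ε a.1) * slope ε a

/-- `a` runs below `b` over some common sheared coordinate. -/
def Under (ε : ℝ) (a b : Arc) : Prop :=
  ∃ t, shear ε a.1 < t ∧ t < shear ε a.2 ∧ shear ε b.1 < t ∧ t < shear ε b.2 ∧
    height ε a t < height ε b t

/-! ### Arcs as graphs of affine functions of the sheared coordinate. -/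

theorem height_left (ε : ℝ) (a : Arc) : height ε a (shear ε a.1) = a.1.2 := by
  simp [height]

theorem height_right {ε : ℝ} {a : Arc} (h : shear ε a.1 < shear ε a.2) :
    height ε a (shear ε a.2) = a.2.2 := by
  have : shear ε a.2 - shear ε a.1 ≠ 0 := by linarith
  rw [height, slope, mul_div_cancel₀ _ this]
  ring

theorem height_eq_right {ε : ℝ} {a : Arc} (h : shear ε a.1 < shear ε a.2) (t : ℝ) :
    height ε a t = a.2.2 + (t - shear ε a.2) * slope ε a := by
  have := height_right h
  unfold height at *
  linear_combination this

/-- Translates between heights and actual points: over sheared coordinate `t` the arc passes through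
the point with first coordinate `t - ε * height ε a t`. This is how planarity becomes a statement
about heights. -/
theorem mem_segment_of_height {ε : ℝ} {a : Arc} {t : ℝ} (h : shear ε a.1 < shear ε a.2)
    (h1 : shear ε a.1 ≤ t) (h2 : t ≤ shear ε a.2) :
    ((t - ε * height ε a t, height ε a t) : Plane) ∈ segment ℝ a.1 a.2 := by
  have hd : 0 < shear ε a.2 - shear ε a.1 := by linarith
  rw [segment_eq_image]
  refine ⟨(t - shear ε a.1) / (shear ε a.2 - shear ε a.1),
    ⟨by apply div_nonneg <;> linarith, by rw [div_le_one hd]; linarith⟩, ?_⟩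
  have hd' := hd.ne'
  ext
  · simp only [height, slope, Prod.fst_add, Prod.smul_fst, smul_eq_mul]
    field_simp
    simp only [shear]
    ring
  · simp only [height, slope, Prod.snd_add, Prod.smul_snd, smul_eq_mul]
    field_simp
    ring

/-- A finite set of arcs in the closed lower half plane, directed to the right in sheared
coordinates that separate end points, which meet at most in end points and carry a flow `w` that is
conserved except at the points `(bx j, 0)`, where an amount `k j` disappears. -/
structure IsPlaneFlow {N m : ℕ} (ε : ℝ) (E : Finset Arc) (w : Arc → ZMod N) (bx : Fin m → ℝ)
    (k : Fin m → ℕ) : Prop where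
  right : ∀ a ∈ E, shear ε a.1 < shear ε a.2
  inj : Set.InjOn (shear ε) (points E)
  planar : ∀ a ∈ E, ∀ b ∈ E, a ≠ b →
    segment ℝ a.1 a.2 ∩ segment ℝ b.1 b.2 ⊆ {a.1, a.2} ∩ {b.1, b.2}
  below : ∀ a ∈ E, a.1.2 ≤ 0 ∧ a.2.2 ≤ 0 ∧ ¬(a.1.2 = 0 ∧ a.2.2 = 0)
  -- This is conservation in weak form: taking `g` to be the indicator of a point gives the
  -- divergence there, and the indicator of a region gives the net flow into it.
  div : ∀ g : Plane → ZMod N, ∑ a ∈ E, w a * (g a.2 - g a.1) = ∑ j, g (bx j, 0) * k j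

theorem fst_mem_points {E : Finset Arc} {a : Arc} (ha : a ∈ E) : a.1 ∈ points E :=
  Finset.mem_union_left _ (Finset.mem_image_of_mem _ ha)

theorem snd_mem_points {E : Finset Arc} {a : Arc} (ha : a ∈ E) : a.2 ∈ points E :=
  Finset.mem_union_right _ (Finset.mem_image_of_mem _ ha)

open Classical in
/-- The label of the face below an arc: minus the total flow through a vertical ray that goes down
from a point just to the right of the left end of the arc. -/
def lowerLabel {N : ℕ} (ε : ℝ) (E : Finset Arc) (w : Arc → ZMod N) (e : Arc) : ZMod N :=
  -∑ a ∈ E, if shear ε a.1 ≤ shear ε e.1 ∧ shear ε e.1 < shear ε a.2 ∧ Under ε a e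
    then w a else 0

/-- The label of the face above an arc. -/
def upperLabel {N : ℕ} (ε : ℝ) (E : Finset Arc) (w : Arc → ZMod N) (e : Arc) : ZMod N :=
  lowerLabel ε E w e - w e

open Classical in
/-- The total flow through the vertical ray going down from `p`, not counting arcs that end
at `p`. -/
def flowBelow {N : ℕ} (ε : ℝ) (E : Finset Arc) (w : Arc → ZMod N) (p : Plane) : ZMod N :=
  ∑ a ∈ E, if shear ε a.1 < shear ε p ∧ shear ε p < shear ε a.2 ∧ height ε a (shear ε p) < p.2
    then w a else 0

/-- When `S` is listed by increasing `r`, the terms are differences of `f` at consecutive partial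
sums. With `r` ordering the arcs at a point from bottom to top, the partial sums are the labels of
the successive faces, up to sign. -/
theorem sum_telescope {α M : Type*} [AddCommGroup M] (f : M → ℤ) (w : α → M) (r : α → ℝ)
    (x : M) (S : Finset α) (hr : Set.InjOn r S) :
    ∑ s ∈ S, (f (x + ∑ a ∈ S with r a < r s, w a) - f (x + (∑ a ∈ S with r a < r s, w a) + w s))
      = f x - f (x + ∑ a ∈ S, w a) := by
  classical
  induction S using Finset.induction_on_max_value r with
  | empty => simp
  | insert b S hb hmax ih =>
    have hlt : ∀ a ∈ S, r a < r b := fun a ha => lt_of_le_of_ne (hmax a ha) fun h =>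
      hb (by
        have := hr (Finset.mem_insert_of_mem ha) (Finset.mem_insert_self _ _) h
        rwa [← this])
    rw [Finset.sum_insert hb, Finset.sum_insert hb, Finset.filter_insert, if_neg (lt_irrefl _),
      Finset.filter_true_of_mem hlt, add_comm (w b)]
    have : ∀ s ∈ S, (insert b S).filter (fun a => r a < r s) = S.filter fun a => r a < r s := by
      intro s hs
      rw [Finset.filter_insert, if_neg (hlt s hs).not_gt]
    have hcongr := Finset.sum_congr (rfl : S = S) fun s hs =>
      congrArg (fun T => f (x + ∑ a ∈ T, w a) - f (x + (∑ a ∈ T, w a) + w s)) (this s hs)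
    rw [hcongr, ih (hr.mono (by simp [Finset.coe_insert]))]
    rw [add_assoc]
    ring

/-! ### The vertical order of arcs that do not cross. -/

namespace IsPlaneFlow

variable {N m : ℕ} {ε : ℝ} {E : Finset Arc} {w : Arc → ZMod N} {bx : Fin m → ℝ} {k : Fin m → ℕ}

theorem meet (H : IsPlaneFlow ε E w bx k) {a b : Arc} (ha : a ∈ E) (hb : b ∈ E) (hab : a ≠ b)
    {t : ℝ} (h1 : shear ε a.1 ≤ t) (h2 : t ≤ shear ε a.2) (h3 : shear ε b.1 ≤ t)
    (h4 : t ≤ shear ε b.2) (h : height ε a t = height ε b t) :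
    (t = shear ε a.1 ∨ t = shear ε a.2) ∧ (t = shear ε b.1 ∨ t = shear ε b.2) := by
  have hA := mem_segment_of_height (H.right a ha) h1 h2
  have hB := mem_segment_of_height (H.right b hb) h3 h4
  rw [← h] at hB
  have := H.planar a ha b hb hab ⟨hA, hB⟩
  have ht : shear ε (t - ε * height ε a t, height ε a t) = t := by simp [shear]
  generalize ((t - ε * height ε a t, height ε a t) : Plane) = p at this ht
  subst ht
  simp only [Set.mem_inter_iff, Set.mem_insert_iff, Set.mem_singleton_iff] at this
  exact ⟨this.1.imp (congrArg _) (congrArg _), this.2.imp (congrArg _) (congrArg _)⟩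

/-- If the order changed between `t` and `t'`, the two affine functions would agree somewhere
strictly between, or at `t'`. The first contradicts planarity; the second is excluded because `t'`
is interior to the range of one of the arcs. -/
theorem height_lt_of_height_lt (H : IsPlaneFlow ε E w bx k) {a b : Arc} (ha : a ∈ E) (hb : b ∈ E)
    {t t' : ℝ} (h1 : shear ε a.1 ≤ t) (h2 : t ≤ shear ε a.2) (h3 : shear ε b.1 ≤ t)
    (h4 : t ≤ shear ε b.2) (h1' : shear ε a.1 ≤ t') (h2' : t' ≤ shear ε a.2)
    (h3' : shear ε b.1 ≤ t') (h4' : t' ≤ shear ε b.2)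
    (hint : (shear ε a.1 < t' ∧ t' < shear ε a.2) ∨ (shear ε b.1 < t' ∧ t' < shear ε b.2))
    (h : height ε a t < height ε b t) : height ε a t' < height ε b t' := by
  have hab : a ≠ b := by rintro rfl; exact lt_irrefl _ h
  by_contra hc
  rcases (not_lt.1 hc).eq_or_lt with hc | hc
  · have := H.meet ha hb hab h1' h2' h3' h4' hc.symm
    rcases hint with ⟨i1, i2⟩ | ⟨i1, i2⟩
    · rcases this.1 with h | h <;> linarith
    · rcases this.2 with h | h <;> linarith
  · -- the affine functions agree strictly between
    set d : ℝ → ℝ := fun x => height ε a x - height ε b x with hd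
    have hdc : ∀ c : ℝ, d (t + c * (t' - t)) = d t + c * (d t' - d t) := by
      intro c
      simp only [hd, height]
      ring
    have hdt : d t < 0 := by simp only [hd]; linarith
    have hdt' : 0 < d t' := by simp only [hd]; linarith
    set c : ℝ := -d t / (d t' - d t) with hc'
    have hpos : 0 < d t' - d t := by linarith
    have c0 : 0 < c := div_pos (by linarith) hpos
    have c1 : c < 1 := by rw [hc', div_lt_one hpos]; linarith
    have hz : d (t + c * (t' - t)) = 0 := by
      rw [hdc, hc', div_mul_cancel₀ _ hpos.ne']
      ring
    have htt : t ≠ t' := by rintro rfl; linarith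
    set s := t + c * (t' - t) with hs
    have hsb : (t < s ∧ s < t') ∨ (t' < s ∧ s < t) := by
      rcases htt.lt_or_gt with h | h
      · left; constructor <;> nlinarith
      · right; constructor <;> nlinarith
    have := H.meet ha hb hab (t := s) (by rcases hsb with h | h <;> linarith)
      (by rcases hsb with h | h <;> linarith) (by rcases hsb with h | h <;> linarith)
      (by rcases hsb with h | h <;> linarith) (by simp only [hd] at hz; linarith)
    rcases hsb with h | h <;> rcases this.1 with h' | h' <;> linarith

/-- `Under` does not depend on the coordinate at which it is tested. The test may even be made at an
end of one arc, as long as that coordinate is interior to the other. -/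
theorem under_iff (H : IsPlaneFlow ε E w bx k) {a b : Arc} (ha : a ∈ E) (hb : b ∈ E)
    {t : ℝ} (h1 : shear ε a.1 ≤ t) (h2 : t ≤ shear ε a.2) (h3 : shear ε b.1 ≤ t)
    (h4 : t ≤ shear ε b.2)
    (hint : (shear ε a.1 < t ∧ t < shear ε a.2) ∨ (shear ε b.1 < t ∧ t < shear ε b.2)) :
    Under ε a b ↔ height ε a t < height ε b t := by
  constructor
  · rintro ⟨s, i1, i2, i3, i4, h⟩
    exact H.height_lt_of_height_lt ha hb i1.le i2.le i3.le i4.le h1 h2 h3 h4 hint h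
  · intro h
    have hra := H.right a ha
    have hrb := H.right b hb
    have hlt : max (shear ε a.1) (shear ε b.1) < min (shear ε a.2) (shear ε b.2) := by
      rw [max_lt_iff, lt_min_iff, lt_min_iff]
      rcases hint with hi | hi <;> refine ⟨⟨?_, ?_⟩, ?_, ?_⟩ <;> linarith
    obtain ⟨s, hs1, hs2⟩ := exists_between hlt
    rw [max_lt_iff] at hs1
    rw [lt_min_iff] at hs2
    exact ⟨s, hs1.1, hs2.1, hs1.2, hs2.2, H.height_lt_of_height_lt ha hb h1 h2 h3 h4 hs1.1.le
      hs2.1.le hs1.2.le hs2.2.le (Or.inl ⟨hs1.1, hs2.1⟩) h⟩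

/-- Arcs fanning out to the right of a point are ordered from bottom to top by slope; for arcs
arriving from the left the order is reversed, hence the sign in `slope_injOn_right`. -/
theorem under_iff_slope_left (H : IsPlaneFlow ε E w bx k) {a b : Arc} (ha : a ∈ E) (hb : b ∈ E)
    (h : a.1 = b.1) : Under ε a b ↔ slope ε a < slope ε b := by
  have hra := H.right a ha
  have hrb := H.right b hb
  obtain ⟨s, hs1, hs2⟩ := exists_between (lt_min hra (h ▸ hrb : shear ε a.1 < shear ε b.2))
  rw [lt_min_iff] at hs2
  rw [H.under_iff ha hb hs1.le hs2.1.le (h ▸ hs1.le) hs2.2.le (Or.inl ⟨hs1, hs2.1⟩), height,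
    height, ← h, add_lt_add_iff_left, mul_lt_mul_iff_right₀ (by linarith)]

theorem under_iff_slope_right (H : IsPlaneFlow ε E w bx k) {a b : Arc} (ha : a ∈ E) (hb : b ∈ E)
    (h : a.2 = b.2) : Under ε a b ↔ slope ε b < slope ε a := by
  have hra := H.right a ha
  have hrb := H.right b hb
  obtain ⟨s, hs1, hs2⟩ := exists_between (max_lt hra (h ▸ hrb : shear ε b.1 < shear ε a.2))
  rw [max_lt_iff] at hs1
  rw [H.under_iff ha hb hs1.1.le hs2.le hs1.2.le (h ▸ hs2.le) (Or.inl ⟨hs1.1, hs2⟩),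
    height_eq_right hra, height_eq_right hrb, ← h, add_lt_add_iff_left,
    mul_lt_mul_left_of_neg (by linarith)]

theorem slope_injOn_left (H : IsPlaneFlow ε E w bx k) (p : Plane) :
    Set.InjOn (slope ε) (E.filter fun a => a.1 = p) := by
  intro a ha b hb h
  simp only [Finset.coe_filter, Set.mem_ofPred_eq] at ha hb
  obtain ⟨ha, rfl⟩ := ha
  obtain ⟨hb, hab⟩ := hb
  by_contra hne
  have hra := H.right a ha
  have hrb := H.right b hb
  obtain ⟨s, hs1, hs2⟩ := exists_between (lt_min hra (hab ▸ hrb : shear ε a.1 < shear ε b.2))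
  rw [lt_min_iff] at hs2
  have := H.meet ha hb hne hs1.le hs2.1.le (hab ▸ hs1.le) hs2.2.le (by rw [height, height, h, hab])
  rcases this.1 with h | h <;> linarith

theorem slope_injOn_right (H : IsPlaneFlow ε E w bx k) (p : Plane) :
    Set.InjOn (fun a => -slope ε a) (E.filter fun a => a.2 = p) := by
  intro a ha b hb h
  simp only [Finset.coe_filter, Set.mem_ofPred_eq] at ha hb
  obtain ⟨ha, rfl⟩ := ha
  obtain ⟨hb, hab⟩ := hb
  by_contra hne
  have hra := H.right a ha
  have hrb := H.right b hb
  obtain ⟨s, hs1, hs2⟩ := exists_between (max_lt hra (hab ▸ hrb : shear ε b.1 < shear ε a.2))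
  rw [max_lt_iff] at hs1
  have := H.meet ha hb hne hs1.1.le hs2.le hs1.2.le (hab ▸ hs2.le)
    (by rw [height_eq_right hra, height_eq_right hrb, neg_inj.1 h, hab])
  rcases this.1 with h | h <;> linarith

/-- An affine function that is nonpositive at both ends can vanish in between only if it is
identically zero, and no arc lies on the axis. So downward rays from a boundary vertex see every arc
that passes over its coordinate. -/
theorem height_neg (H : IsPlaneFlow ε E w bx k) {a : Arc} (ha : a ∈ E) {t : ℝ}
    (h1 : shear ε a.1 < t) (h2 : t < shear ε a.2) : height ε a t < 0 := by
  have hr := H.right a ha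
  obtain ⟨h3, h4, h5⟩ := H.below a ha
  have e1 := height_eq_right hr t
  have e2 : height ε a t = a.1.2 + (t - shear ε a.1) * slope ε a := rfl
  by_contra hc
  rw [not_lt] at hc
  have s1 : 0 ≤ slope ε a := by
    by_contra hs
    nlinarith [mul_pos (sub_pos.2 h1) (neg_pos.2 (not_le.1 hs))]
  have s2 : slope ε a ≤ 0 := by
    by_contra hs
    nlinarith [mul_pos (sub_pos.2 h2) (not_le.1 hs)]
  have s3 : slope ε a = 0 := le_antisymm s2 s1
  rw [s3, mul_zero, add_zero] at e1 e2
  exact h5 ⟨by linarith, by linarith⟩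

/-! ### Labels of the faces around a point and next to the axis. -/

open Classical in
/-- The flow below an arc can be read off at either end. -/
theorem lowerLabel_eq (H : IsPlaneFlow ε E w bx k) {e : Arc} (he : e ∈ E) :
    lowerLabel ε E w e =
      -∑ a ∈ E, if shear ε a.1 < shear ε e.2 ∧ shear ε e.2 ≤ shear ε a.2 ∧ Under ε a e
        then w a else 0 := by
  have hre := H.right e he
  -- `g` is the indicator of the open region under `e`. That region contains no boundary vertex, so
  -- its net inflow is zero; hence what enters it under the left end of `e` leaves it under the
  -- right end.
  let g : Plane → ZMod N := fun p =>
    if shear ε e.1 < shear ε p ∧ shear ε p < shear ε e.2 ∧ p.2 < height ε e (shear ε p)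
    then 1 else 0
  have h0 : ∑ a ∈ E, w a * (g a.2 - g a.1) = 0 := by
    rw [H.div]
    refine Finset.sum_eq_zero fun j _ => ?_
    have : g (bx j, 0) = 0 := if_neg fun h => by
      have := H.height_neg he h.1 h.2.1
      have := h.2.2
      simp only at this
      linarith
    rw [this, zero_mul]
  unfold lowerLabel
  rw [neg_inj, ← sub_eq_zero, ← Finset.sum_sub_distrib]
  refine Eq.trans ?_ h0
  refine Finset.sum_congr rfl fun a ha => ?_
  have hra := H.right a ha
  -- If the coordinate ranges of `a` and `e` overlap, then `a` stays on one side of `e`, and the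
  -- values of `g` at its ends are decided by `Under` and by comparing coordinates. Otherwise every
  -- term vanishes.
  by_cases hc : shear ε a.1 < shear ε e.2 ∧ shear ε e.1 < shear ε a.2
  · have g2 : g a.2 = if shear ε a.2 < shear ε e.2 ∧ Under ε a e then 1 else 0 := by
      refine if_congr ?_ rfl rfl
      constructor
      · rintro ⟨h1, h2, h3⟩
        exact ⟨h2, (H.under_iff ha he hra.le le_rfl h1.le h2.le (Or.inr ⟨h1, h2⟩)).2
          (by rwa [height_right hra])⟩
      · rintro ⟨h2, h3⟩
        refine ⟨hc.2, h2, ?_⟩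
        have := (H.under_iff ha he hra.le le_rfl hc.2.le h2.le (Or.inr ⟨hc.2, h2⟩)).1 h3
        rwa [height_right hra] at this
    have g1 : g a.1 = if shear ε e.1 < shear ε a.1 ∧ Under ε a e then 1 else 0 := by
      refine if_congr ?_ rfl rfl
      constructor
      · rintro ⟨h1, h2, h3⟩
        exact ⟨h1, (H.under_iff ha he le_rfl hra.le h1.le h2.le (Or.inr ⟨h1, h2⟩)).2
          (by rwa [height_left])⟩
      · rintro ⟨h1, h3⟩
        refine ⟨h1, hc.1, ?_⟩
        have := (H.under_iff ha he le_rfl hra.le h1.le hc.1.le (Or.inr ⟨h1, hc.1⟩)).1 h3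
        rwa [height_left] at this
    rw [g1, g2]
    by_cases hU : Under ε a e
    · simp only [hU, hc.1, hc.2, and_true, true_and, ← not_lt]
      split_ifs <;> simp
    · simp [hU]
  · have hU : ¬Under ε a e := by
      rintro ⟨t, h1, h2, h3, h4, -⟩
      exact hc ⟨by linarith, by linarith⟩
    have g2 : g a.2 = 0 := if_neg fun h => hc ⟨by linarith [h.2.1], h.1⟩
    have g1 : g a.1 = 0 := if_neg fun h => hc ⟨h.2.1, by linarith [h.1]⟩
    simp [hU, g1, g2]

/-- An arc below `e` near its left end `p` either passes strictly under `p` or leaves `p` with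
smaller slope, because the sheared coordinate determines the end point. The first kind gives a term
that depends only on `p`. -/
theorem lowerLabel_left (H : IsPlaneFlow ε E w bx k) {e : Arc} (he : e ∈ E) {p : Plane}
    (hp : e.1 = p) :
    lowerLabel ε E w e =
      -(flowBelow ε E w p + ∑ a ∈ (E.filter fun a => a.1 = p) with slope ε a < slope ε e, w a) := by
  classical
  subst hp
  have hre := H.right e he
  unfold lowerLabel flowBelow
  rw [neg_inj, Finset.filter_filter, Finset.sum_filter, ← Finset.sum_add_distrib]
  refine Finset.sum_congr rfl fun a ha => ?_
  have hra := H.right a ha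
  rcases lt_trichotomy (shear ε a.1) (shear ε e.1) with h | h | h
  · have hne : a.1 ≠ e.1 := fun h' => by rw [h'] at h; exact lt_irrefl _ h
    simp only [h, h.le, hne, true_and, false_and, if_false, add_zero]
    refine if_congr (and_congr_right fun h2 => ?_) rfl rfl
    rw [H.under_iff ha he h.le h2.le le_rfl hre.le (Or.inl ⟨h, h2⟩), height_left]
  · have h' : a.1 = e.1 := H.inj (fst_mem_points ha) (fst_mem_points he) h
    have h2 : shear ε e.1 < shear ε a.2 := h ▸ hra
    simp [h', h2, H.under_iff_slope_left ha he h']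
  · have hne : a.1 ≠ e.1 := fun h' => by rw [h'] at h; exact lt_irrefl _ h
    simp [h.not_gt, h.not_ge, hne]

theorem lowerLabel_right (H : IsPlaneFlow ε E w bx k) {e : Arc} (he : e ∈ E) {p : Plane}
    (hp : e.2 = p) :
    lowerLabel ε E w e =
      -(flowBelow ε E w p +
        ∑ a ∈ (E.filter fun a => a.2 = p) with -slope ε a < -slope ε e, w a) := by
  classical
  subst hp
  have hre := H.right e he
  rw [H.lowerLabel_eq he]
  unfold flowBelow
  rw [neg_inj, Finset.filter_filter, Finset.sum_filter, ← Finset.sum_add_distrib]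
  refine Finset.sum_congr rfl fun a ha => ?_
  have hra := H.right a ha
  rcases lt_trichotomy (shear ε a.2) (shear ε e.2) with h | h | h
  · have hne : a.2 ≠ e.2 := fun h' => by rw [h'] at h; exact lt_irrefl _ h
    simp [h.not_gt, h.not_ge, hne]
  · have h' : a.2 = e.2 := H.inj (snd_mem_points ha) (snd_mem_points he) h
    have h2 : shear ε a.1 < shear ε e.2 := h ▸ hra
    simp [h', h2, H.under_iff_slope_right ha he h']
  · have hne : a.2 ≠ e.2 := fun h' => by rw [h'] at h; exact lt_irrefl _ h
    simp only [h, h.le, hne, true_and, false_and, if_false, add_zero]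
    refine if_congr (and_congr_right fun h2 => ?_) rfl rfl
    rw [H.under_iff ha he h2.le h.le hre.le le_rfl (Or.inl ⟨h2, h⟩), height_right hre]

/-- Going around a point below the axis, the faces close up. -/
theorem sum_label_eq (H : IsPlaneFlow ε E w bx k) {p : Plane} (hp : p.2 < 0) (f : ZMod N → ℤ) :
    ∑ e ∈ E with e.1 = p, f (lowerLabel ε E w e) + ∑ e ∈ E with e.2 = p, f (upperLabel ε E w e) =
    ∑ e ∈ E with e.2 = p, f (lowerLabel ε E w e)
      + ∑ e ∈ E with e.1 = p, f (upperLabel ε E w e) := by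
  classical
  -- Both fans at `p` start at the face directly below `p`, with label `-flowBelow ε E w p`. The
  -- partial sums run upwards through the faces on the right of `p` in `h1` and on its left in `h2`.
  have h1 := sum_telescope (fun z => f (-z)) w (slope ε) (flowBelow ε E w p)
    (E.filter fun a => a.1 = p) (H.slope_injOn_left p)
  have h2 := sum_telescope (fun z => f (-z)) w (fun a => -slope ε a) (flowBelow ε E w p)
    (E.filter fun a => a.2 = p) (H.slope_injOn_right p)
  -- Conservation at `p`: the two fans also end at the same label above `p`.
  have h3 : ∑ e ∈ E with e.1 = p, w e = ∑ e ∈ E with e.2 = p, w e := by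
    have := H.div fun x => if x = p then 1 else 0
    rw [Finset.sum_eq_zero (s := Finset.univ) fun j _ => by
      rw [if_neg, zero_mul]; rintro rfl; exact lt_irrefl _ hp] at this
    simp only [mul_sub, mul_ite, mul_one, mul_zero, Finset.sum_sub_distrib,
      ← Finset.sum_filter] at this
    exact (sub_eq_zero.1 this).symm
  have c1 : ∀ e ∈ E.filter fun a => a.1 = p, lowerLabel ε E w e = _ := fun e he =>
    H.lowerLabel_left (Finset.mem_filter.1 he).1 (Finset.mem_filter.1 he).2
  have c2 : ∀ e ∈ E.filter fun a => a.2 = p, lowerLabel ε E w e = _ := fun e he =>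
    H.lowerLabel_right (Finset.mem_filter.1 he).1 (Finset.mem_filter.1 he).2
  have e1 : ∑ e ∈ E with e.1 = p, (f (lowerLabel ε E w e) - f (upperLabel ε E w e)) = _ :=
    (Finset.sum_congr rfl fun e he => by
      rw [upperLabel, c1 e he, sub_eq_add_neg _ (w e), ← neg_add]).trans h1
  have e2 : ∑ e ∈ E with e.2 = p, (f (lowerLabel ε E w e) - f (upperLabel ε E w e)) = _ :=
    (Finset.sum_congr rfl fun e he => by
      rw [upperLabel, c2 e he, sub_eq_add_neg _ (w e), ← neg_add]).trans h2
  rw [← h3] at e2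
  simp only [Finset.sum_sub_distrib] at e1 e2
  linarith

/-- The labels on both sides of an arc that leaves a boundary vertex to the right. -/
theorem label_bdry_left (H : IsPlaneFlow ε E w bx k) {e : Arc} (he : e ∈ E) {j : Fin m}
    (hbx : StrictMono bx) (hp : e.1 = (bx j, 0)) (h1 : ∀ a ∈ E, a.1 = (bx j, 0) → a = e)
    (h2 : ∀ a ∈ E, a.2 ≠ (bx j, 0)) :
    lowerLabel ε E w e = ((∑ i with i < j, k i : ℕ) : ZMod N) ∧
      upperLabel ε E w e = ((∑ i with i ≤ j, k i : ℕ) : ZMod N) := by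
  classical
  have hsh : ∀ i, shear ε (bx i, 0) = bx i := fun i => by simp [shear]
  have hw : -w e = k j := by
    have := H.div fun x => if x = (bx j, 0) then 1 else 0
    rw [Finset.sum_eq_single e, Finset.sum_eq_single j] at this
    · simpa [hp, h2 e he] using this
    · intro i _ hij
      rw [if_neg, zero_mul]
      intro h
      exact hij (hbx.injective (congrArg Prod.fst h))
    · simp
    · intro a ha hae
      rw [if_neg (h2 a ha), if_neg fun h => hae (h1 a ha h), sub_zero, mul_zero]
    · exact fun h => absurd he h
  have hlow : lowerLabel ε E w e = ((∑ i with i < j, k i : ℕ) : ZMod N) := by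
    rw [H.lowerLabel_left he hp, Finset.sum_eq_zero, add_zero]
    · have hd := H.div fun x => if shear ε x < bx j then 1 else 0
      simp only [hsh, hbx.lt_iff_lt, ite_mul, one_mul, zero_mul, ← Finset.sum_filter] at hd
      push_cast
      rw [← hd, flowBelow, ← Finset.sum_neg_distrib]
      refine Finset.sum_congr rfl fun a ha => ?_
      have hra := H.right a ha
      have hne : shear ε a.2 ≠ bx j := fun h => h2 a ha (by
        rw [← hp]
        exact H.inj (snd_mem_points ha) (fst_mem_points he) (by rw [hp, hsh, h]))
      rw [hsh]
      have hh : (shear ε a.1 < bx j ∧ bx j < shear ε a.2 ∧ height ε a (bx j) < 0) ↔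
          (shear ε a.1 < bx j ∧ ¬ shear ε a.2 < bx j) := by
        constructor
        · rintro ⟨i1, i2, -⟩
          exact ⟨i1, i2.not_gt⟩
        · rintro ⟨i1, i2⟩
          have i3 := lt_of_le_of_ne (not_lt.1 i2) hne.symm
          exact ⟨i1, i3, H.height_neg ha i1 i3⟩
      simp only [hh]
      by_cases i1 : shear ε a.1 < bx j <;> by_cases i2 : shear ε a.2 < bx j <;> simp [i1, i2]
      linarith
    · intro a ha
      simp only [Finset.mem_filter] at ha
      rw [h1 a ha.1.1 ha.1.2] at ha
      exact absurd ha.2 (lt_irrefl _)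
  refine ⟨hlow, ?_⟩
  rw [upperLabel, hlow, sub_eq_add_neg, hw,
    show (Finset.univ.filter fun i => i ≤ j) = insert j (Finset.univ.filter fun i => i < j) by
      ext; simp [le_iff_eq_or_lt], Finset.sum_insert (by simp)]
  push_cast
  ring

/-- The labels on both sides of an arc that enters a boundary vertex from the left. -/
theorem label_bdry_right (H : IsPlaneFlow ε E w bx k) {e : Arc} (he : e ∈ E) {j : Fin m}
    (hbx : StrictMono bx) (hp : e.2 = (bx j, 0)) (h1 : ∀ a ∈ E, a.2 = (bx j, 0) → a = e)
    (h2 : ∀ a ∈ E, a.1 ≠ (bx j, 0)) :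
    lowerLabel ε E w e = ((∑ i with i ≤ j, k i : ℕ) : ZMod N) ∧
      upperLabel ε E w e = ((∑ i with i < j, k i : ℕ) : ZMod N) := by
  classical
  have hsh : ∀ i, shear ε (bx i, 0) = bx i := fun i => by simp [shear]
  have hw : w e = k j := by
    have := H.div fun x => if x = (bx j, 0) then 1 else 0
    rw [Finset.sum_eq_single e, Finset.sum_eq_single j] at this
    · simpa [hp, h2 e he] using this
    · intro i _ hij
      rw [if_neg, zero_mul]
      intro h
      exact hij (hbx.injective (congrArg Prod.fst h))
    · simp
    · intro a ha hae
      rw [if_neg (h2 a ha), if_neg fun h => hae (h1 a ha h), sub_zero, mul_zero]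
    · exact fun h => absurd he h
  have hlow : lowerLabel ε E w e = ((∑ i with i ≤ j, k i : ℕ) : ZMod N) := by
    rw [H.lowerLabel_right he hp, Finset.sum_eq_zero, add_zero]
    · have hd := H.div fun x => if shear ε x ≤ bx j then 1 else 0
      simp only [hsh, hbx.le_iff_le, ite_mul, one_mul, zero_mul, ← Finset.sum_filter] at hd
      push_cast
      rw [← hd, flowBelow, ← Finset.sum_neg_distrib]
      refine Finset.sum_congr rfl fun a ha => ?_
      have hra := H.right a ha
      have hne : shear ε a.1 ≠ bx j := fun h => h2 a ha (by
        rw [← hp]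
        exact H.inj (fst_mem_points ha) (snd_mem_points he) (by rw [hp, hsh, h]))
      rw [hsh]
      have hh : (shear ε a.1 < bx j ∧ bx j < shear ε a.2 ∧ height ε a (bx j) < 0) ↔
          (shear ε a.1 ≤ bx j ∧ ¬ shear ε a.2 ≤ bx j) := by
        constructor
        · rintro ⟨i1, i2, -⟩
          exact ⟨i1.le, i2.not_ge⟩
        · rintro ⟨i1, i2⟩
          have i3 := lt_of_le_of_ne i1 hne
          exact ⟨i3, not_le.1 i2, H.height_neg ha i3 (not_le.1 i2)⟩
      simp only [hh]
      by_cases i1 : shear ε a.1 ≤ bx j <;> by_cases i2 : shear ε a.2 ≤ bx j <;> simp [i1, i2]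
      linarith
    · intro a ha
      simp only [Finset.mem_filter] at ha
      rw [h1 a ha.1.1 ha.1.2] at ha
      exact absurd ha.2 (lt_irrefl _)
  refine ⟨hlow, ?_⟩
  rw [upperLabel, hlow, hw,
    show (Finset.univ.filter fun i => i ≤ j) = insert j (Finset.univ.filter fun i => i < j) by
      ext; simp [le_iff_eq_or_lt], Finset.sum_insert (by simp)]
  push_cast
  ring

end IsPlaneFlow

/-! ## Decomposition into strands -/

/-- `P` is the set of arcs of a path that visits no point twice, and either joins two points of the
axis or is closed. -/
def IsSimplePath (P : Finset Arc) : Prop :=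
  ∃ l : List Plane, l.Nodup ∧
    ((2 ≤ l.length ∧ (∀ p ∈ l.head?, p.2 = 0) ∧ (∀ p ∈ l.getLast?, p.2 = 0) ∧
        P = (l.zip l.tail).toFinset) ∨
      (3 ≤ l.length ∧ P = (l.zip (l.rotate 1)).toFinset))

theorem mem_zip_tail {l : List Plane} {a : Arc} :
    a ∈ l.zip l.tail ↔ ∃ (i : ℕ) (h : i + 1 < l.length), a = (l[i], l[i + 1]) := by
  rw [List.mem_iff_getElem]
  constructor
  · rintro ⟨i, hi, rfl⟩
    simp only [List.length_zip, List.length_tail, lt_min_iff] at hi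
    exact ⟨i, by omega, by simp⟩
  · rintro ⟨i, hi, rfl⟩
    exact ⟨i, by simp only [List.length_zip, List.length_tail, lt_min_iff]; omega, by simp⟩

theorem mem_zip_rotate {l : List Plane} {a : Arc} :
    a ∈ l.zip (l.rotate 1) ↔ ∃ (i : ℕ) (h : i < l.length),
      a = (l[i], l[(i + 1) % l.length]'(Nat.mod_lt _ (by omega))) := by
  rw [List.mem_iff_getElem]
  constructor
  · rintro ⟨i, hi, rfl⟩
    simp only [List.length_zip, List.length_rotate, lt_min_iff] at hi
    exact ⟨i, hi.1, by simp [List.getElem_rotate]⟩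
  · rintro ⟨i, hi, rfl⟩
    exact ⟨i, by simpa using hi, by simp [List.getElem_rotate]⟩

/-- A set of arcs with at most one arc out of and at most one arc into each point, which are
balanced below the axis. -/
structure IsPathSystem (A : Finset Arc) : Prop where
  out : ∀ a ∈ A, ∀ b ∈ A, a.1 = b.1 → a = b
  inn : ∀ a ∈ A, ∀ b ∈ A, a.2 = b.2 → a = b
  bal : ∀ p : Plane, p.2 ≠ 0 → ((∃ a ∈ A, a.1 = p) ↔ ∃ a ∈ A, a.2 = p)
  ne : ∀ a ∈ A, a.1 ≠ a.2
  swap : ∀ a ∈ A, a.swap ∉ A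

/-- All points of a path with at least two points belong to `points A`, so lengths are bounded; `e`
itself provides a path of length two. -/
theorem IsPathSystem.exists_longest {A : Finset Arc} {e : Arc} (he : e ∈ A) (hne : e.1 ≠ e.2) :
    ∃ l : List Plane, (2 ≤ l.length ∧ l.Nodup ∧ l.IsChain (fun p r => (p, r) ∈ A)) ∧
      ∀ l' : List Plane, l'.Nodup → l'.IsChain (fun p r => (p, r) ∈ A) →
        l'.length ≤ l.length := by
  classical
  let s : Set ℕ := {d | ∃ l : List Plane, (2 ≤ l.length ∧ l.Nodup ∧
    l.IsChain (fun p r => (p, r) ∈ A)) ∧ l.length = d}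
  have hb : BddAbove s := by
    refine ⟨(points A).card, ?_⟩
    rintro _ ⟨l, ⟨h2, hl, hc⟩, rfl⟩
    rw [← List.toFinset_card_of_nodup hl]
    refine Finset.card_le_card fun p hp => ?_
    rw [List.mem_toFinset, List.mem_iff_getElem] at hp
    obtain ⟨i, hi, rfl⟩ := hp
    rw [List.isChain_iff_getElem] at hc
    rcases Nat.lt_or_ge (i + 1) l.length with h | h
    · exact fst_mem_points (hc i h)
    · obtain ⟨i, rfl⟩ : ∃ i', i = i' + 1 := ⟨i - 1, by omega⟩
      exact snd_mem_points (hc i hi)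
  have hne : s.Nonempty := ⟨2, [e.1, e.2], ⟨by simp, by simpa using hne, by simpa using he⟩, rfl⟩
  obtain ⟨l, hl, hd⟩ := Nat.sSup_mem hne hb
  refine ⟨l, hl, fun l' h1 h2 => ?_⟩
  rcases Nat.lt_or_ge l'.length 2 with h | h
  · omega
  · rw [hd]
    exact le_csSup hb ⟨l', ⟨h, h1, h2⟩, rfl⟩

/-- A longest directed path is already a whole component. Uniqueness of arcs out of and into a point
makes it absorb every arc at its points: either its last point leads back to the first, or it cannot
be extended and balance forces both ends onto the axis. -/
theorem IsPathSystem.exists_path {A : Finset Arc} (H : IsPathSystem A) (hA : A.Nonempty) :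
    ∃ P ⊆ A, P.Nonempty ∧ IsSimplePath P ∧ Disjoint (points P) (points (A \ P)) := by
  classical
  obtain ⟨e, he⟩ := hA
  obtain ⟨l, ⟨h2, hl, hc⟩, hmax⟩ := IsPathSystem.exists_longest he (H.ne e he)
  have hc' := List.isChain_iff_getElem.1 hc
  -- it suffices to have a path through the points of `l` that captures all arcs at these points
  have key : ∀ P : Finset Arc, IsSimplePath P → P ⊆ A → P.Nonempty →
      (∀ a ∈ P, a.1 ∈ l ∧ a.2 ∈ l) → (∀ a ∈ A, a.1 ∈ l ∨ a.2 ∈ l → a ∈ P) →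
      ∃ P ⊆ A, P.Nonempty ∧ IsSimplePath P ∧ Disjoint (points P) (points (A \ P)) := by
    intro P hP hPA hPne hPl hPa
    refine ⟨P, hPA, hPne, hP, Finset.disjoint_left.2 fun p hp hp' => ?_⟩
    have hpl : p ∈ l := by
      simp only [points, Finset.mem_union, Finset.mem_image] at hp
      rcases hp with ⟨a, ha, rfl⟩ | ⟨a, ha, rfl⟩
      exacts [(hPl a ha).1, (hPl a ha).2]
    simp only [points, Finset.mem_union, Finset.mem_image, Finset.mem_sdiff] at hp'
    rcases hp' with ⟨a, ⟨ha, hn⟩, rfl⟩ | ⟨a, ⟨ha, hn⟩, rfl⟩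
    exacts [hn (hPa a ha (Or.inl hpl)), hn (hPa a ha (Or.inr hpl))]
  set z := l[l.length - 1] with hz
  set y := l[0] with hy
  have hlast : ∀ i (h : i < l.length), l[i] = z → i = l.length - 1 := fun i h hi =>
    (hl.getElem_inj_iff).1 hi
  by_cases hzo : ∃ a ∈ A, a.1 = z
  · obtain ⟨a, ha, haz⟩ := hzo
    have hal : a.2 ∈ l := by
      by_contra hn
      have := hmax (l ++ [a.2]) (by
        rw [List.nodup_append]
        refine ⟨hl, by simp, ?_⟩
        rintro p hp q hq rfl
        rw [List.mem_singleton] at hq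
        exact hn (hq ▸ hp)) (by
        rw [List.isChain_append]
        refine ⟨hc, by simp, ?_⟩
        intro x hx y hy
        rw [List.getLast?_eq_getElem?, List.getElem?_eq_getElem (by omega)] at hx
        simp only [Option.mem_def, Option.some.injEq, List.head?_cons] at hx hy
        rw [← hx, ← hy, ← hz, ← haz]
        exact ha)
      simp at this
    obtain ⟨i, hi, hia⟩ := List.mem_iff_getElem.1 hal
    -- At any later point, `a` would be a second arc into that point.
    have hi0 : i = 0 := by
      by_contra h0
      obtain ⟨i, rfl⟩ : ∃ i', i = i' + 1 := ⟨i - 1, by omega⟩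
      have := H.inn _ (hc' i hi) a ha hia
      have := hlast i (by omega) (by rw [← haz, ← this])
      omega
    subst hi0
    have haeq : a = (z, y) := Prod.ext haz hia.symm
    -- A cycle with two points would use an arc and its reverse.
    have h3 : 3 ≤ l.length := by
      by_contra h
      have hlen : l.length = 2 := by omega
      have := H.swap _ (hc' 0 (by omega))
      apply this
      have hz1 : z = l[1] := by simp [hz, hlen]
      rw [haeq, hz1] at ha
      exact ha
    have hrot : ∀ (i : ℕ) (h : i < l.length),
        (l[i], l[(i + 1) % l.length]'(Nat.mod_lt _ (by omega))) ∈ A := by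
      intro i h
      rcases Nat.lt_or_ge (i + 1) l.length with h' | h'
      · simp only [Nat.mod_eq_of_lt h']
        exact hc' i h'
      · obtain rfl : i = l.length - 1 := by omega
        simp only [show l.length - 1 + 1 = l.length by omega, Nat.mod_self]
        rw [← hz, ← hy, ← haeq]
        exact ha
    refine key (l.zip (l.rotate 1)).toFinset ⟨l, hl, Or.inr ⟨h3, rfl⟩⟩ ?_ ?_ ?_ ?_
    · intro d hd
      rw [List.mem_toFinset, mem_zip_rotate] at hd
      obtain ⟨i, h, rfl⟩ := hd
      exact hrot i h
    · exact ⟨_, List.mem_toFinset.2 (mem_zip_rotate.2 ⟨0, by omega, rfl⟩)⟩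
    · intro d hd
      rw [List.mem_toFinset, mem_zip_rotate] at hd
      obtain ⟨i, h, rfl⟩ := hd
      exact ⟨List.getElem_mem _, List.getElem_mem _⟩
    · intro d hd hdl
      rw [List.mem_toFinset, mem_zip_rotate]
      rcases hdl with hdl | hdl
      · obtain ⟨i, h, hi⟩ := List.mem_iff_getElem.1 hdl
        exact ⟨i, h, H.out _ hd _ (hrot i h) hi.symm⟩
      · obtain ⟨i, h, hi⟩ := List.mem_iff_getElem.1 hdl
        rcases i with _ | i
        · refine ⟨l.length - 1, by omega, H.inn _ hd _ (hrot _ _) ?_⟩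
          simp only [show l.length - 1 + 1 = l.length by omega, Nat.mod_self]
          exact hi.symm
        · refine ⟨i, by omega, H.inn _ hd _ (hrot i _) ?_⟩
          simp only [Nat.mod_eq_of_lt h]
          exact hi.symm
  -- An arc into the first point could start only at the last point of the path: a start outside the
  -- path would lengthen it, and an earlier point already has its outgoing arc.
  · have hyi : ¬ ∃ a ∈ A, a.2 = y := by
      rintro ⟨a, ha, hay⟩
      have hal : a.1 ∈ l := by
        by_contra hn
        have := hmax (a.1 :: l) (List.nodup_cons.2 ⟨hn, hl⟩) (by
          rw [List.isChain_cons]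
          refine ⟨?_, hc⟩
          intro x hx
          rw [List.head?_eq_getElem?, List.getElem?_eq_getElem (by omega)] at hx
          simp only [Option.mem_def, Option.some.injEq] at hx
          rw [← hx, ← hy, ← hay]
          exact ha)
        simp at this
      obtain ⟨i, hi, hia⟩ := List.mem_iff_getElem.1 hal
      rcases Nat.lt_or_ge (i + 1) l.length with h | h
      · have h1 := H.out _ (hc' i h) a ha hia
        have h2 : l[i + 1] = l[0] := by rw [← hy, ← hay, ← h1]
        have := hl.getElem_inj_iff.1 h2
        omega
      · obtain rfl : i = l.length - 1 := by omega
        exact hzo ⟨a, ha, by rw [← hia]⟩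
    have hy0 : y.2 = 0 := by
      by_contra h
      exact hyi ((H.bal y h).1 ⟨_, hc' 0 (by omega), rfl⟩)
    have hz0 : z.2 = 0 := by
      by_contra h
      refine hzo ((H.bal z h).2 ⟨_, hc' (l.length - 2) (by omega), ?_⟩)
      simp only [hz, show l.length - 2 + 1 = l.length - 1 by omega]
    refine key (l.zip l.tail).toFinset ⟨l, hl, Or.inl ⟨h2, ?_, ?_, rfl⟩⟩ ?_ ?_ ?_ ?_
    · intro x hx
      rw [List.head?_eq_getElem?, List.getElem?_eq_getElem (by omega)] at hx
      simp only [Option.mem_def, Option.some.injEq] at hx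
      rw [← hx]
      exact hy0
    · intro x hx
      rw [List.getLast?_eq_getElem?, List.getElem?_eq_getElem (by omega)] at hx
      simp only [Option.mem_def, Option.some.injEq] at hx
      rw [← hx]
      exact hz0
    · intro d hd
      rw [List.mem_toFinset, mem_zip_tail] at hd
      obtain ⟨i, h, rfl⟩ := hd
      exact hc' i h
    · exact ⟨_, List.mem_toFinset.2 (mem_zip_tail.2 ⟨0, by omega, rfl⟩)⟩
    · intro d hd
      rw [List.mem_toFinset, mem_zip_tail] at hd
      obtain ⟨i, h, rfl⟩ := hd
      exact ⟨List.getElem_mem _, List.getElem_mem _⟩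
    · intro d hd hdl
      rw [List.mem_toFinset, mem_zip_tail]
      rcases hdl with hdl | hdl
      · obtain ⟨i, h, hi⟩ := List.mem_iff_getElem.1 hdl
        rcases Nat.lt_or_ge (i + 1) l.length with h' | h'
        · exact ⟨i, h', H.out _ hd _ (hc' i h') hi.symm⟩
        · obtain rfl : i = l.length - 1 := by omega
          exact absurd ⟨d, hd, hi.symm⟩ hzo
      · obtain ⟨i, h, hi⟩ := List.mem_iff_getElem.1 hdl
        rcases i with _ | i
        · exact absurd ⟨d, hd, hi.symm⟩ hyi
        · exact ⟨i, h, H.inn _ hd _ (hc' i h) hi.symm⟩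

/-- Removing a component leaves a path system. Balance survives because the removed arcs share no
point with the remaining ones. -/
theorem IsPathSystem.exists_decomposition {A : Finset Arc} (H : IsPathSystem A) :
    ∃ C : Finset (Finset Arc), (∀ P ∈ C, P ⊆ A ∧ IsSimplePath P) ∧
      (∀ P ∈ C, ∀ Q ∈ C, P ≠ Q → Disjoint (points P) (points Q)) ∧
      ∀ a ∈ A, ∃ P ∈ C, a ∈ P := by
  classical
  induction hd : A.card using Nat.strong_induction_on generalizing A with
  | _ d ih =>
    rcases A.eq_empty_or_nonempty with rfl | hne
    · exact ⟨∅, by simp, by simp, by simp⟩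
    obtain ⟨P, hPA, hPne, hP, hdisj⟩ := H.exists_path hne
    have hsub : A \ P ⊆ A := Finset.sdiff_subset
    have H' : IsPathSystem (A \ P) := by
      refine ⟨fun a ha b hb => H.out a (hsub ha) b (hsub hb),
        fun a ha b hb => H.inn a (hsub ha) b (hsub hb), ?_,
        fun a ha => H.ne a (hsub ha),
        fun a ha h => H.swap a (hsub ha) (hsub h)⟩
      intro p hp
      rw [Finset.disjoint_left] at hdisj
      constructor
      · rintro ⟨a, ha, rfl⟩
        obtain ⟨b, hb, hba⟩ := (H.bal a.1 hp).1 ⟨a, hsub ha, rfl⟩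
        refine ⟨b, Finset.mem_sdiff.2 ⟨hb, fun hbP => ?_⟩, hba⟩
        exact hdisj (snd_mem_points hbP) (hba ▸ fst_mem_points ha)
      · rintro ⟨a, ha, rfl⟩
        obtain ⟨b, hb, hba⟩ := (H.bal a.2 hp).2 ⟨a, hsub ha, rfl⟩
        refine ⟨b, Finset.mem_sdiff.2 ⟨hb, fun hbP => ?_⟩, hba⟩
        exact hdisj (fst_mem_points hbP) (hba ▸ snd_mem_points ha)
    have hlt : (A \ P).card < d := by
      rw [← hd]
      refine Finset.card_lt_card (Finset.ssubset_iff_subset_ne.2 ⟨hsub, fun h => ?_⟩)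
      obtain ⟨a, ha⟩ := hPne
      have := hPA ha
      rw [← h, Finset.mem_sdiff] at this
      exact this.2 ha
    obtain ⟨C, h1, h2, h3⟩ := ih _ hlt H' rfl
    have hpts : ∀ Q ∈ C, Disjoint (points P) (points Q) := fun Q hQ =>
      hdisj.mono_right (Finset.union_subset_union (Finset.image_subset_image (h1 Q hQ).1)
        (Finset.image_subset_image (h1 Q hQ).1))
    refine ⟨insert P C, ?_, ?_, ?_⟩
    · intro Q hQ
      rcases Finset.mem_insert.1 hQ with rfl | hQ
      · exact ⟨hPA, hP⟩
      · exact ⟨(h1 Q hQ).1.trans hsub, (h1 Q hQ).2⟩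
    · intro Q hQ R hR hQR
      rcases Finset.mem_insert.1 hQ with h | h <;> rcases Finset.mem_insert.1 hR with h' | h'
      · exact absurd (h.trans h'.symm) hQR
      · exact h ▸ hpts R h'
      · exact h' ▸ (hpts Q h).symm
      · exact h2 Q h R h' hQR
    · intro a ha
      by_cases haP : a ∈ P
      · exact ⟨P, Finset.mem_insert_self _ _, haP⟩
      · obtain ⟨Q, hQ, haQ⟩ := h3 a (Finset.mem_sdiff.2 ⟨ha, haP⟩)
        exact ⟨Q, Finset.mem_insert_of_mem hQ, haQ⟩

/-! ## The flow of a web graph -/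

/-- Two points at different heights collide for only one value of `ε`, and two points at equal
height never do. Finitely many values are to be avoided. -/
theorem exists_shear_injOn (s : Finset Plane) : ∃ ε : ℝ, Set.InjOn (shear ε) s := by
  classical
  obtain ⟨ε, hε⟩ := Infinite.exists_notMem_finset
    ((s ×ˢ s).image fun x => -(x.1.1 - x.2.1) / (x.1.2 - x.2.2))
  refine ⟨ε, fun p hp r hr h => ?_⟩
  simp only [shear] at h
  have h2 : p.2 = r.2 := by
    by_contra hne
    refine hε (Finset.mem_image.2 ⟨(p, r), Finset.mem_product.2 ⟨hp, hr⟩, ?_⟩)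
    have : p.2 - r.2 ≠ 0 := sub_ne_zero.2 hne
    simp only
    rw [div_eq_iff this]
    linear_combination -h
  exact Prod.ext (by rw [h2] at h; linarith) h2

/-! ### A web graph as a plane flow modulo `n`. -/

namespace FontaineWeb

variable {n m : ℕ} {G : FontaineWeb n m}

theorem mem_arcs {a : Arc} : a ∈ G.arcs ↔ a ∈ G.seg ∨ a.swap ∈ G.seg := by
  unfold arcs
  rw [Finset.mem_union, Finset.mem_image]
  refine or_congr_right ⟨?_, fun h => ⟨_, h, Prod.swap_swap _⟩⟩
  rintro ⟨b, hb, rfl⟩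
  rwa [Prod.swap_swap]

theorem swap_mem_arcs {a : Arc} : a.swap ∈ G.arcs ↔ a ∈ G.arcs := by
  rw [mem_arcs, mem_arcs, Prod.swap_swap, or_comm]

/-- Opposite pieces would share their midpoint, which is not an end point. -/
theorem swap_notMem_seg {a : Arc} (ha : a ∈ G.seg) : a.swap ∉ G.seg := by
  intro h
  have hne := G.seg_ne a ha
  have hp := G.planar a ha _ h (fun h => hne (congrArg Prod.fst h))
  have hm : midpoint ℝ a.1 a.2 ∈ ({a.1, a.2} : Set Plane) :=
    (hp ⟨midpoint_mem_segment _ _, by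
      rw [Prod.fst_swap, Prod.snd_swap, segment_symm]
      exact midpoint_mem_segment _ _⟩).1
  rcases hm with hm | hm
  · exact hne ((midpoint_eq_left_iff ℝ).1 hm)
  · exact hne ((midpoint_eq_right_iff ℝ).1 hm)

theorem arcs_ne {a : Arc} (ha : a ∈ G.arcs) : a.1 ≠ a.2 := by
  rcases mem_arcs.1 ha with h | h
  · exact G.seg_ne a h
  · exact (G.seg_ne _ h).symm

theorem arcs_below {a : Arc} (ha : a ∈ G.arcs) : a.1.2 ≤ 0 ∧ a.2.2 ≤ 0 := by
  rcases mem_arcs.1 ha with h | h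
  · exact ⟨(G.seg_below _ h).1, (G.seg_below _ h).2.1⟩
  · exact ⟨(G.seg_below _ h).2.1, (G.seg_below _ h).1⟩

/-- The weights of a web graph, as an antisymmetric function on its arcs. -/
def flow (G : FontaineWeb n m) (a : Arc) : ZMod n :=
  if a ∈ G.seg then (G.wt a : ZMod n) else -(G.wt a.swap : ZMod n)

theorem flow_swap {a : Arc} (ha : a ∈ G.arcs) : G.flow a.swap = -G.flow a := by
  unfold flow
  rcases mem_arcs.1 ha with h | h
  · rw [if_neg (swap_notMem_seg h), if_pos h, Prod.swap_swap]
  · have := swap_notMem_seg h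
    rw [Prod.swap_swap] at this
    rw [if_pos h, if_neg this, neg_neg]

theorem flow_ne_zero {a : Arc} (ha : a ∈ G.arcs) : G.flow a ≠ 0 := by
  have key : ∀ s ∈ G.seg, (G.wt s : ZMod n) ≠ 0 := by
    intro s hs h
    rw [ZMod.natCast_eq_zero_iff] at h
    have h1 := G.wt_mem s hs
    have := Nat.le_of_dvd (by omega) h
    omega
  unfold flow
  split_ifs with h
  · exact key a h
  · exact neg_ne_zero.2 (key _ ((mem_arcs.1 ha).resolve_left h))

/-- The arcs directed to the right in sheared coordinates. -/
def rightArcs (G : FontaineWeb n m) (ε : ℝ) : Finset Arc :=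
  G.arcs.filter fun a => shear ε a.1 < shear ε a.2

theorem mem_points_of_mem_arcs {a : Arc} (ha : a ∈ G.arcs) :
    a.1 ∈ points G.seg ∧ a.2 ∈ points G.seg := by
  rcases mem_arcs.1 ha with h | h
  · exact ⟨fst_mem_points h, snd_mem_points h⟩
  · exact ⟨snd_mem_points h, fst_mem_points h⟩

variable {ε : ℝ}

theorem mem_rightArcs_or (hε : Set.InjOn (shear ε) (points G.seg)) {a : Arc} (ha : a ∈ G.arcs) :
    (a ∈ G.rightArcs ε ∧ ¬ shear ε a.2 < shear ε a.1) ∨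
      (a.swap ∈ G.rightArcs ε ∧ ¬ shear ε a.1 < shear ε a.2) := by
  have hne : shear ε a.1 ≠ shear ε a.2 := fun h =>
    arcs_ne ha (hε (mem_points_of_mem_arcs ha).1 (mem_points_of_mem_arcs ha).2 h)
  rcases hne.lt_or_gt with h | h
  · exact Or.inl ⟨Finset.mem_filter.2 ⟨ha, h⟩, h.not_gt⟩
  · exact Or.inr ⟨Finset.mem_filter.2 ⟨swap_mem_arcs.2 ha, h⟩, h.not_gt⟩

theorem sum_arcs (hε : Set.InjOn (shear ε) (points G.seg)) {M : Type*} [AddCommMonoid M]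
    (g : Arc → M) :
    ∑ a ∈ G.arcs, g a = ∑ a ∈ G.rightArcs ε, g a + ∑ a ∈ G.rightArcs ε, g a.swap := by
  classical
  rw [← Finset.sum_filter_add_sum_filter_not G.arcs (fun a => shear ε a.1 < shear ε a.2)]
  congr 1
  refine Finset.sum_bij' (fun a _ => a.swap) (fun a _ => a.swap) ?_ ?_ ?_ ?_ ?_
  · intro a ha
    rw [Finset.mem_filter] at ha
    rcases mem_rightArcs_or hε ha.1 with h | h
    · exact absurd (Finset.mem_filter.1 h.1).2 ha.2
    · exact h.1
  · intro a ha
    have ha := Finset.mem_filter.1 ha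
    exact Finset.mem_filter.2 ⟨swap_mem_arcs.2 ha.1, ha.2.not_gt⟩
  · simp
  · simp
  · simp

theorem sum_arcs_seg {M : Type*} [AddCommMonoid M] (g : Arc → M) :
    ∑ a ∈ G.arcs, g a = ∑ a ∈ G.seg, g a + ∑ a ∈ G.seg, g a.swap := by
  classical
  unfold arcs
  rw [Finset.sum_union, Finset.sum_image (fun a _ b _ h => Prod.swap_injective h)]
  rw [Finset.disjoint_left]
  intro a ha h
  obtain ⟨b, hb, rfl⟩ := Finset.mem_image.1 h
  exact swap_notMem_seg hb ha

/-- Reversing an arc changes the sign of both the flow and the difference of `g`, so each piece may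
be oriented as convenient. -/
theorem sum_rightArcs (hε : Set.InjOn (shear ε) (points G.seg)) (g : Plane → ZMod n) :
    ∑ a ∈ G.rightArcs ε, G.flow a * (g a.2 - g a.1)
      = ∑ s ∈ G.seg, (G.wt s : ZMod n) * (g s.2 - g s.1) := by
  classical
  have hseg : ∀ s ∈ G.seg, s ∈ G.arcs := fun s hs => mem_arcs.2 (Or.inl hs)
  refine Finset.sum_bij'
    (fun a _ => if a ∈ G.seg then a else a.swap)
    (fun s _ => if shear ε s.1 < shear ε s.2 then s else s.swap) ?_ ?_ ?_ ?_ ?_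
  · intro a ha
    have ha := (Finset.mem_filter.1 ha).1
    split_ifs with h
    · exact h
    · exact (mem_arcs.1 ha).resolve_left h
  · intro s hs
    rcases mem_rightArcs_or hε (hseg s hs) with h | h
    · rw [if_pos (Finset.mem_filter.1 h.1).2]
      exact h.1
    · rw [if_neg h.2]
      exact h.1
  · intro a ha
    have hr := (Finset.mem_filter.1 ha).2
    by_cases h : a ∈ G.seg
    · simp only [if_pos h, if_pos hr]
    · simp only [if_neg h, Prod.fst_swap, Prod.snd_swap, if_neg hr.not_gt, Prod.swap_swap]
  · intro s hs
    by_cases h : shear ε s.1 < shear ε s.2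
    · simp only [if_pos h, if_pos hs]
    · simp only [if_neg h, if_neg (swap_notMem_seg hs), Prod.swap_swap]
  · intro a ha
    unfold flow
    by_cases h : a ∈ G.seg
    · simp only [if_pos h]
    · simp only [if_neg h, Prod.fst_swap, Prod.snd_swap]
      ring

/-- Summation by parts: regroup by end points. Vertices and bends below the axis contribute zero
modulo `n`; on the axis, an outgoing weight `ℓ` counts as `-ℓ`, which is the boundary weight `n - ℓ`
modulo `n`. -/
theorem sum_seg (G : FontaineWeb n m) (g : Plane → ZMod n) :
    ∑ s ∈ G.seg, (G.wt s : ZMod n) * (g s.2 - g s.1)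
      = ∑ j, g (G.bx j, 0) * (G.boundaryWeight j : ZMod n) := by
  classical
  have hbd : Function.Injective fun j => ((G.bx j, 0) : Plane) := fun i j h =>
    G.bx_strictMono.injective (congrArg Prod.fst h)
  set B : Finset Plane := Finset.univ.image fun j => ((G.bx j, 0) : Plane) with hB
  have h1 : ∑ s ∈ G.seg, (G.wt s : ZMod n) * (g s.2 - g s.1) = ∑ p ∈ points G.seg ∪ B,
      g p * (∑ s ∈ G.seg with s.2 = p, (G.wt s : ZMod n)
        - ∑ s ∈ G.seg with s.1 = p, (G.wt s : ZMod n)) := by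
    simp only [mul_sub, Finset.sum_sub_distrib, Finset.mul_sum]
    congr 1
    · rw [← Finset.sum_fiberwise_of_maps_to (t := points G.seg ∪ B) (g := fun s : Arc => s.2)
        (fun s hs => Finset.mem_union_left _ (snd_mem_points hs))]
      refine Finset.sum_congr rfl fun p _ => Finset.sum_congr rfl fun s hs => ?_
      rw [← (Finset.mem_filter.1 hs).2, mul_comm]
    · rw [← Finset.sum_fiberwise_of_maps_to (t := points G.seg ∪ B) (g := fun s : Arc => s.1)
        (fun s hs => Finset.mem_union_left _ (fst_mem_points hs))]
      refine Finset.sum_congr rfl fun p _ => Finset.sum_congr rfl fun s hs => ?_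
      rw [← (Finset.mem_filter.1 hs).2, mul_comm]
  rw [h1, ← Finset.sum_subset (s₁ := B) Finset.subset_union_right, hB,
    Finset.sum_image (fun i _ j _ h => hbd h)]
  · refine Finset.sum_congr rfl fun j _ => ?_
    congr 1
    unfold boundaryWeight bdry
    push_cast
    rw [sub_eq_add_neg, ← Finset.sum_neg_distrib]
    congr 1
    refine Finset.sum_congr rfl fun s hs => ?_
    have := G.wt_mem s (Finset.mem_filter.1 hs).1
    rw [Nat.cast_sub (by omega)]
    simp
  · intro p hp hpB
    rcases Finset.mem_union.1 hp with hp | hp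
    swap
    · exact absurd hp hpB
    have hz : ∑ s ∈ G.seg with s.2 = p, (G.wt s : ZMod n)
        - ∑ s ∈ G.seg with s.1 = p, (G.wt s : ZMod n) = 0 := by
      obtain ⟨s, hs, hsp⟩ : ∃ s ∈ G.seg, p = s.1 ∨ p = s.2 := by
        simp only [points, Finset.mem_union, Finset.mem_image] at hp
        rcases hp with ⟨s, hs, rfl⟩ | ⟨s, hs, rfl⟩
        exacts [⟨s, hs, Or.inl rfl⟩, ⟨s, hs, Or.inr rfl⟩]
      have hlt : p.2 < 0 := by
        have hle : p.2 ≤ 0 := by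
          rcases hsp with rfl | rfl
          exacts [(G.seg_below s hs).1, (G.seg_below s hs).2.1]
        refine lt_of_le_of_ne hle fun h0 => hpB ?_
        obtain ⟨j, hj⟩ := G.axis s hs p hsp h0
        exact Finset.mem_image.2 ⟨j, Finset.mem_univ _, hj.symm⟩
      rcases G.interior p hlt with h | ⟨-, h⟩ | ⟨-, -, h⟩
      · rcases hsp with h' | h'
        exacts [absurd h'.symm (h s hs).1, absurd h'.symm (h s hs).2]
      · have := (ZMod.intCast_zmod_eq_zero_iff_dvd _ n).2 h
        push_cast at this
        exact this
      · rw [sub_eq_zero]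
        exact_mod_cast congrArg (Nat.cast : ℕ → ZMod n) h
    rw [hz, mul_zero]

theorem isPlaneFlow (hε : Set.InjOn (shear ε) (points G.seg)) :
    IsPlaneFlow ε (G.rightArcs ε) G.flow G.bx G.boundaryWeight where
  right a ha := (Finset.mem_filter.1 ha).2
  inj := by
    refine hε.mono fun p hp => ?_
    simp only [points, Finset.coe_union, Finset.coe_image, Set.mem_union, Set.mem_image] at hp
    rcases hp with ⟨a, ha, rfl⟩ | ⟨a, ha, rfl⟩
    exacts [(mem_points_of_mem_arcs (Finset.mem_filter.1 ha).1).1,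
      (mem_points_of_mem_arcs (Finset.mem_filter.1 ha).1).2]
  planar := by
    have key : ∀ a ∈ G.arcs, ∃ s ∈ G.seg, (a = s ∨ a = s.swap) ∧
        segment ℝ a.1 a.2 = segment ℝ s.1 s.2 ∧ ({a.1, a.2} : Set Plane) = {s.1, s.2} := by
      intro a ha
      rcases mem_arcs.1 ha with h | h
      · exact ⟨a, h, Or.inl rfl, rfl, rfl⟩
      · exact ⟨a.swap, h, Or.inr (Prod.swap_swap a).symm, segment_symm _ _ _, Set.pair_comm _ _⟩
    intro a ha b hb hab
    rw [rightArcs, Finset.mem_filter] at ha hb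
    obtain ⟨s, hs, has, h1, h2⟩ := key a ha.1
    obtain ⟨t, ht, hbt, h3, h4⟩ := key b hb.1
    rw [h1, h2, h3, h4]
    -- Two different arcs cannot come from the same piece, since only one of its directions runs to
    -- the right.
    refine G.planar s hs t ht fun hst => ?_
    subst hst
    rcases has with rfl | rfl <;> rcases hbt with rfl | rfl
    · exact hab rfl
    · exact ha.2.not_gt hb.2
    · exact ha.2.not_gt hb.2
    · exact hab rfl
  below a ha := by
    rcases mem_arcs.1 (Finset.mem_filter.1 ha).1 with h | h
    · exact G.seg_below a h
    · obtain ⟨h1, h2, h3⟩ := G.seg_below _ h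
      exact ⟨h2, h1, fun h => h3 h.symm⟩
  div g := (sum_rightArcs hε g).trans (G.sum_seg g)

/-! ### The arcs of one colour. -/

/-- The label of the face to the right of an arc. -/
def faceLabel (G : FontaineWeb n m) (ε : ℝ) (a : Arc) : ZMod n :=
  if shear ε a.1 < shear ε a.2 then lowerLabel ε (G.rightArcs ε) G.flow a
  else upperLabel ε (G.rightArcs ε) G.flow a.swap

theorem faceLabel_of_mem {a : Arc} (ha : a ∈ G.rightArcs ε) :
    G.faceLabel ε a = lowerLabel ε (G.rightArcs ε) G.flow a ∧
      G.faceLabel ε a.swap = upperLabel ε (G.rightArcs ε) G.flow a := by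
  have h := (Finset.mem_filter.1 ha).2
  unfold faceLabel
  rw [if_pos h, Prod.fst_swap, Prod.snd_swap, if_neg h.not_gt, Prod.swap_swap]
  exact ⟨rfl, rfl⟩

theorem faceLabel_swap (hε : Set.InjOn (shear ε) (points G.seg)) {a : Arc} (ha : a ∈ G.arcs) :
    G.faceLabel ε a = G.faceLabel ε a.swap + G.flow a := by
  rcases mem_rightArcs_or hε ha with h | h
  · rw [(faceLabel_of_mem h.1).1, (faceLabel_of_mem h.1).2, upperLabel, sub_add_cancel]
  · have h1 := (faceLabel_of_mem h.1).1
    have h2 := (faceLabel_of_mem h.1).2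
    rw [Prod.swap_swap] at h2
    rw [h1, h2, upperLabel, flow_swap ha, sub_neg_eq_add]

/-- The labels differ by the weight, which lies strictly between `0` and `n`. Thus no colour uses an
edge in both directions. -/
theorem faceLabel_ne (hε : Set.InjOn (shear ε) (points G.seg)) {a : Arc} (ha : a ∈ G.arcs) :
    G.faceLabel ε a ≠ G.faceLabel ε a.swap := by
  rw [faceLabel_swap hε ha]
  exact fun h => flow_ne_zero ha (left_eq_add.1 h.symm)

/-- The arcs with a face of label `c` to their right. -/
def labelArcs (G : FontaineWeb n m) (ε : ℝ) (c : ZMod n) : Finset Arc :=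
  G.arcs.filter fun a => G.faceLabel ε a = c

theorem mem_labelArcs {c : ZMod n} {a : Arc} :
    a ∈ G.labelArcs ε c ↔ a ∈ G.arcs ∧ G.faceLabel ε a = c := Finset.mem_filter

/-- This is `sum_label_eq` for the indicator of `c`: an arc to the right has its lower face on its
right, and its reverse has the upper one. -/
theorem card_labelArcs_eq (hε : Set.InjOn (shear ε) (points G.seg)) (c : ZMod n) {p : Plane}
    (hp : p.2 < 0) :
    ((G.labelArcs ε c).filter fun a => a.1 = p).card
      = ((G.labelArcs ε c).filter fun a => a.2 = p).card := by
  classical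
  have h := (isPlaneFlow hε).sum_label_eq hp fun z => if z = c then 1 else 0
  -- The Boolean treats both counts at once: `true` for arcs out of `p`, `false` for arcs into `p`.
  have hs : ∀ (b : Bool), ((((G.labelArcs ε c).filter fun a => cond b a.1 a.2 = p).card : ℕ) : ℤ)
      = (∑ e ∈ G.rightArcs ε with cond b e.1 e.2 = p,
          if lowerLabel ε (G.rightArcs ε) G.flow e = c then 1 else 0)
        + ∑ e ∈ G.rightArcs ε with cond b e.2 e.1 = p,
          if upperLabel ε (G.rightArcs ε) G.flow e = c then 1 else 0 := by
    intro b
    rw [labelArcs, Finset.filter_filter, Finset.card_filter]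
    push_cast
    rw [sum_arcs hε, Finset.sum_filter, Finset.sum_filter]
    congr 1
    · refine Finset.sum_congr rfl fun a ha => ?_
      rw [(faceLabel_of_mem ha).1]
      split_ifs <;> simp_all
    · refine Finset.sum_congr rfl fun a ha => ?_
      rw [(faceLabel_of_mem ha).2]
      cases b <;> simp only [cond_true, cond_false, Prod.fst_swap, Prod.snd_swap] <;>
        split_ifs <;> simp_all
  have h1 := hs true
  have h2 := hs false
  simp only [cond_true, cond_false] at h1 h2
  omega

theorem card_arcs_fst (G : FontaineWeb n m) (p : Plane) : (G.arcs.filter fun a => a.1 = p).card =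
    (G.seg.filter fun a => a.2 = p).card + (G.seg.filter fun a => a.1 = p).card := by
  simp only [Finset.card_filter]
  rw [sum_arcs_seg, add_comm]
  rfl

/-- After the incoming arcs are reversed, they stay distinct from the outgoing ones because the two
sides of an edge have different labels. -/
theorem card_labelArcs_add_le (hε : Set.InjOn (shear ε) (points G.seg)) (c : ZMod n) (p : Plane) :
    ((G.labelArcs ε c).filter fun a => a.1 = p).card
      + ((G.labelArcs ε c).filter fun a => a.2 = p).card
      ≤ (G.arcs.filter fun a => a.1 = p).card := by
  classical
  rw [← Finset.card_image_of_injective ((G.labelArcs ε c).filter fun a => a.2 = p)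
    Prod.swap_injective, ← Finset.card_union_of_disjoint]
  · refine Finset.card_le_card fun a ha => ?_
    rcases Finset.mem_union.1 ha with ha | ha
    · rw [Finset.mem_filter, mem_labelArcs] at ha
      exact Finset.mem_filter.2 ⟨ha.1.1, ha.2⟩
    · obtain ⟨b, hb, rfl⟩ := Finset.mem_image.1 ha
      rw [Finset.mem_filter, mem_labelArcs] at hb
      exact Finset.mem_filter.2 ⟨swap_mem_arcs.2 hb.1.1, hb.2⟩
  · rw [Finset.disjoint_left]
    intro a ha h
    obtain ⟨b, hb, rfl⟩ := Finset.mem_image.1 h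
    rw [Finset.mem_filter, mem_labelArcs] at ha hb
    exact faceLabel_ne hε hb.1.1 (hb.1.2.trans ha.1.2.symm)

/-- Below the axis, equally many arcs of the colour enter and leave a point, using distinct edges
out of at most three, so there is at most one of each. On the axis, univalence gives the same bound
without balance. -/
theorem isPathSystem (hε : Set.InjOn (shear ε) (points G.seg)) (c : ZMod n) :
    IsPathSystem (G.labelArcs ε c) := by
  classical
  have hle : ∀ p : Plane, ((G.labelArcs ε c).filter fun a => a.1 = p).card ≤ 1 ∧
      ((G.labelArcs ε c).filter fun a => a.2 = p).card ≤ 1 := by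
    intro p
    have h1 := card_labelArcs_add_le hε c p
    rw [card_arcs_fst] at h1
    rcases lt_trichotomy p.2 0 with h | h | h
    · have h2 := card_labelArcs_eq hε c h
      have h3 : (G.seg.filter fun a => a.2 = p).card + (G.seg.filter fun a => a.1 = p).card ≤ 3 := by
        rcases G.interior p h with h | h | h
        · rw [Finset.filter_false_of_mem fun s hs => (h s hs).2,
            Finset.filter_false_of_mem fun s hs => (h s hs).1]
          simp
        · omega
        · omega
      omega
    · have h3 : (G.seg.filter fun a => a.2 = p).card + (G.seg.filter fun a => a.1 = p).card ≤ 1 := by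
        by_cases hj : ∃ j, p = (G.bx j, 0)
        · obtain ⟨j, rfl⟩ := hj
          exact (G.univalent j).le
        · rw [Finset.filter_false_of_mem fun s hs he => hj (G.axis s hs p (Or.inr he.symm) h),
            Finset.filter_false_of_mem fun s hs he => hj (G.axis s hs p (Or.inl he.symm) h)]
          simp
      omega
    · have h3 : ∀ a ∈ G.arcs, a.1 ≠ p := by
        rintro a ha rfl
        exact h.not_ge (arcs_below ha).1
      rw [← card_arcs_fst, Finset.filter_false_of_mem (s := G.arcs) h3] at h1
      simp only [Finset.card_empty] at h1
      omega
  refine ⟨fun a ha b hb h => ?_, fun a ha b hb h => ?_, fun p hp => ?_, fun a ha => ?_,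
    fun a ha h => ?_⟩
  · exact Finset.card_le_one.1 (hle a.1).1 a (Finset.mem_filter.2 ⟨ha, rfl⟩) b
      (Finset.mem_filter.2 ⟨hb, h.symm⟩)
  · exact Finset.card_le_one.1 (hle a.2).2 a (Finset.mem_filter.2 ⟨ha, rfl⟩) b
      (Finset.mem_filter.2 ⟨hb, h.symm⟩)
  · have key : ((G.labelArcs ε c).filter fun a => a.1 = p).Nonempty ↔
        ((G.labelArcs ε c).filter fun a => a.2 = p).Nonempty := by
      rcases lt_or_gt_of_ne hp with h | h
      · rw [← Finset.card_pos, ← Finset.card_pos, card_labelArcs_eq hε c h]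
      · have hb : ∀ a ∈ G.labelArcs ε c, a.1.2 ≤ 0 ∧ a.2.2 ≤ 0 := fun a ha =>
          arcs_below (mem_labelArcs.1 ha).1
        constructor
        · rintro ⟨a, ha⟩
          rw [Finset.mem_filter] at ha
          have := (hb a ha.1).1
          rw [ha.2] at this
          linarith
        · rintro ⟨a, ha⟩
          rw [Finset.mem_filter] at ha
          have := (hb a ha.1).2
          rw [ha.2] at this
          linarith
    simpa only [Finset.Nonempty, Finset.mem_filter] using key
  · exact arcs_ne (mem_labelArcs.1 ha).1
  · exact faceLabel_ne hε (mem_labelArcs.1 ha).1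
      ((mem_labelArcs.1 ha).2.trans (mem_labelArcs.1 h).2.symm)

theorem bdryArc_spec (G : FontaineWeb n m) (j : Fin m) :
    (G.bdryArc j).2 = G.bdry j ∧ G.bdryArc j ∈ G.arcs := by
  obtain ⟨h1, h2⟩ := (G.exists_bdryArc j).choose_spec
  exact ⟨h1, mem_arcs.2 (h2.imp (fun h => h.1) fun h => h.1)⟩

/-- The faces to the right and to the left of the `j`-th boundary edge. -/
theorem faceLabel_bdryArc (hε : Set.InjOn (shear ε) (points G.seg)) (j : Fin m) :
    G.faceLabel ε (G.bdryArc j) = ((∑ i with i ≤ j, G.boundaryWeight i : ℕ) : ZMod n) ∧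
      G.faceLabel ε (G.bdryArc j).swap = ((∑ i with i < j, G.boundaryWeight i : ℕ) : ZMod n) := by
  classical
  obtain ⟨h2, hm⟩ := G.bdryArc_spec j
  set a := G.bdryArc j
  have huniq : ∀ b ∈ G.arcs, b.2 = G.bdry j → b = a := by
    intro b hb hb2
    have hc : (G.arcs.filter fun a => a.1 = (G.bx j, 0)).card = 1 := by
      rw [card_arcs_fst]
      exact G.univalent j
    have := Finset.card_le_one.1 hc.le b.swap (Finset.mem_filter.2 ⟨swap_mem_arcs.2 hb, hb2⟩)
      a.swap (Finset.mem_filter.2 ⟨swap_mem_arcs.2 hm, h2⟩)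
    exact Prod.swap_injective this
  rcases mem_rightArcs_or hε hm with h | h
  · rw [(faceLabel_of_mem h.1).1, (faceLabel_of_mem h.1).2]
    refine (isPlaneFlow hε).label_bdry_right h.1 G.bx_strictMono h2
      (fun b hb hbj => huniq b (Finset.mem_filter.1 hb).1 hbj) fun b hb hbj => ?_
    have := huniq b.swap (swap_mem_arcs.2 (Finset.mem_filter.1 hb).1) hbj
    have h3 := (Finset.mem_filter.1 hb).2
    rw [← this] at h
    exact h.2 h3
  · have h1 := faceLabel_of_mem h.1
    rw [Prod.swap_swap] at h1
    rw [h1.1, h1.2]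
    refine ((isPlaneFlow hε).label_bdry_left h.1 G.bx_strictMono h2
      (fun b hb hbj => ?_) fun b hb hbj => ?_).symm
    · rw [← huniq b.swap (swap_mem_arcs.2 (Finset.mem_filter.1 hb).1) hbj, Prod.swap_swap]
    · have := huniq b (Finset.mem_filter.1 hb).1 hbj
      have h3 := (Finset.mem_filter.1 hb).2
      rw [this] at h3
      exact h.2 h3

end FontaineWeb

/-! ## The base stranding -/

/-- The colours on an edge with a face of label `r` to its right and a face of label `l` to its
left. -/
def edgeCoroot (r l c : ℕ) : ℤ := if c = 0 then 0 else if c = r then 1 else if c = l then -1 else 0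

theorem isGreatest_edgeCoroot {r l : ℕ} (h : r ≠ l) :
    IsGreatest {c | edgeCoroot r l c ≠ 0} (max r l) := by
  constructor
  · simp only [Set.mem_ofPred_eq, edgeCoroot]
    split_ifs <;> omega
  · intro c hc
    simp only [Set.mem_ofPred_eq, edgeCoroot] at hc
    split_ifs at hc <;> omega

theorem edgeCoroot_max {r l : ℕ} (h : r ≠ l) :
    edgeCoroot r l (max r l) = if l < r then 1 else -1 := by
  unfold edgeCoroot
  split_ifs <;> omega

/-- Either `r = l + ℓ`, where the larger colour runs forwards and the sum is `ℓ`, or `r = l + ℓ -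
n`, where it runs backwards and the sum is `ℓ - n`. A label `0` contributes nothing to the sum, so
its missing strand does no harm. -/
theorem validOn_edgeCoroot {n ℓ r l : ℕ} (hr : r < n) (hl : l < n) (hℓ : 1 ≤ ℓ)
    (hℓn : ℓ < n) (h : r ≡ l + ℓ [MOD n]) : ValidOn n ℓ (edgeCoroot r l) := by
  have hcases : r = l + ℓ ∨ r + n = l + ℓ := by
    unfold Nat.ModEq at h
    rw [Nat.mod_eq_of_lt hr] at h
    rcases Nat.lt_or_ge (l + ℓ) n with h1 | h1
    · rw [Nat.mod_eq_of_lt h1] at h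
      exact Or.inl h
    · rw [Nat.mod_eq_sub_mod h1, Nat.mod_eq_of_lt (by omega)] at h
      omega
  have hne : r ≠ l := by omega
  refine ⟨fun c d hcd hc hd _ => ?_, max r l, isGreatest_edgeCoroot hne, ?_⟩
  · unfold edgeCoroot at *
    split_ifs at * <;> simp_all
  · have hs : ∀ c ∈ Finset.Icc 1 (n - 1), edgeCoroot r l c * (c : ℤ)
        = (if r = c then (c : ℤ) else 0) - if l = c then (c : ℤ) else 0 := by
      intro c hc
      rw [Finset.mem_Icc] at hc
      unfold edgeCoroot
      split_ifs <;> omega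
    rw [Finset.sum_congr rfl hs, Finset.sum_sub_distrib, Finset.sum_ite_eq, Finset.sum_ite_eq,
      edgeCoroot_max hne]
    simp only [Finset.mem_Icc]
    by_cases hlt : l < r
    · rw [if_pos hlt, if_pos rfl]
      split_ifs <;> omega
    · rw [if_neg hlt, if_neg (show ¬((-1 : ℤ) = 1) by decide)]
      split_ifs <;> omega

/-- Summing the colours beyond position `i` yields one for `r` exactly when `i < r`, and minus one
for `l` exactly when `i < l`. The extra `1` appears when the largest colour runs backwards. -/
theorem binaryLabel_edgeCoroot {n r l : ℕ} (hr : r < n) (hl : l < n) (h : r ≠ l) (i : Fin n) :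
    binaryLabel n (edgeCoroot r l) i =
      if l < r then fundWeight n r i - fundWeight n l i
      else 1 + fundWeight n r i - fundWeight n l i := by
  have hmax : (∃ c, IsGreatest {c | edgeCoroot r l c ≠ 0} c ∧ edgeCoroot r l c = -1) ↔ ¬ l < r := by
    have hm := edgeCoroot_max h
    constructor
    · rintro ⟨c, hc, hc'⟩ hlt
      rw [hc.unique (isGreatest_edgeCoroot h), hm, if_pos hlt] at hc'
      omega
    · intro hlt
      exact ⟨_, isGreatest_edgeCoroot h, by rw [hm, if_neg hlt]⟩
  have hs : ∀ c ∈ Finset.Icc (i.val + 1) (n - 1), edgeCoroot r l c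
      = (if r = c then 1 else 0) - if l = c then 1 else 0 := by
    intro c hc
    rw [Finset.mem_Icc] at hc
    unfold edgeCoroot
    split_ifs <;> omega
  unfold binaryLabel fundWeight
  simp only [hmax]
  rw [Finset.sum_congr rfl hs, Finset.sum_sub_distrib, Finset.sum_ite_eq, Finset.sum_ite_eq]
  simp only [Finset.mem_Icc]
  have := i.isLt
  split_ifs <;> omega

-- The strands of colour `c` are the components of the boundary of the region labelled `c`. Every
-- arc with right label `c` lies on such a strand, so the colours on an edge are read off from its
-- two labels.
open FontaineWeb in
theorem exists_baseStranding {n m : ℕ} (hn : 2 ≤ n) (G : FontaineWeb n m) {ε : ℝ}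
    (hε : Set.InjOn (shear ε) (points G.seg)) :
    ∃ S, IsStranding G S ∧ ∀ a ∈ G.arcs,
      coroot S a = edgeCoroot (G.faceLabel ε a).val (G.faceLabel ε a.swap).val := by
  classical
  have : NeZero n := ⟨by omega⟩
  choose C h1 h2 h3 using fun c : ZMod n => (isPathSystem hε c).exists_decomposition
  -- The residue `0` is omitted: the region labelled `0` gets no strands.
  let S : Finset (ℕ × Finset Arc) :=
    (Finset.Icc 1 (n - 1)).biUnion fun c => (C (c : ZMod n)).image fun P => (c, P)
  have hS : ∀ c P, (c, P) ∈ S ↔ (1 ≤ c ∧ c ≤ n - 1) ∧ P ∈ C (c : ZMod n) := by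
    intro c P
    simp only [S, Finset.mem_biUnion, Finset.mem_Icc, Finset.mem_image, Prod.mk.injEq]
    constructor
    · rintro ⟨d, hd, Q, hQ, rfl, rfl⟩
      exact ⟨hd, hQ⟩
    · rintro ⟨hc, hP⟩
      exact ⟨c, hc, P, hP, rfl, rfl⟩
  have hmem : ∀ a ∈ G.arcs, ∀ c, (∃ P, (c, P) ∈ S ∧ a ∈ P) ↔
      c ≠ 0 ∧ c = (G.faceLabel ε a).val := by
    intro a ha c
    constructor
    · rintro ⟨P, hP, haP⟩
      rw [hS] at hP
      have := (mem_labelArcs.1 ((h1 _ P hP.2).1 haP)).2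
      rw [this, ZMod.val_cast_of_lt (by omega)]
      exact ⟨by omega, rfl⟩
    · rintro ⟨hc0, hc⟩
      have hlt := ZMod.val_lt (G.faceLabel ε a)
      obtain ⟨P, hP, haP⟩ := h3 (c : ZMod n) a (mem_labelArcs.2 ⟨ha, by
        rw [hc, ZMod.natCast_zmod_val]⟩)
      exact ⟨P, (hS _ _).2 ⟨by omega, hP⟩, haP⟩
  refine ⟨S, ⟨?_, ?_⟩, ?_⟩
  · rintro ⟨c, P⟩ hs
    rw [hS] at hs
    refine ⟨hs.1.1, hs.1.2, (h1 _ P hs.2).1.trans (Finset.filter_subset _ _), (h1 _ P hs.2).2⟩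
  · rintro ⟨c, P⟩ hs ⟨d, Q⟩ ht hst hcd
    simp only at hcd
    subst hcd
    rw [hS] at hs ht
    exact h2 _ P hs.2 Q ht.2 fun h => hst (by rw [h])
  · intro a ha
    funext c
    unfold coroot edgeCoroot
    simp only [hmem a ha, hmem _ (swap_mem_arcs.2 ha)]
    split_ifs <;> first | rfl | tauto

/-- Every web graph has a valid stranding whose monomial is the base monomial. -/
theorem exists_stranding_baseLabel {n m : ℕ} (hn : 2 ≤ n) (G : FontaineWeb n m) :
    ∃ S ∈ strandings G, ∀ j, bdryLabel G S j = baseLabel n G.boundaryWeight j := by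
  have : NeZero n := ⟨by omega⟩
  obtain ⟨ε, hε⟩ := exists_shear_injOn (points G.seg)
  obtain ⟨S, hS, hcor⟩ := exists_baseStranding hn G hε
  refine ⟨S, mem_strandings.2 ⟨hS, fun e he => ?_⟩, fun j => ?_⟩
  · have hea := FontaineWeb.mem_arcs.2 (Or.inl he)
    have hw := G.wt_mem e he
    rw [hcor e hea]
    refine validOn_edgeCoroot (ZMod.val_lt _) (ZMod.val_lt _) hw.1 (by omega) ?_
    rw [← ZMod.natCast_eq_natCast_iff]
    push_cast
    rw [ZMod.natCast_zmod_val, ZMod.natCast_zmod_val, FontaineWeb.faceLabel_swap hε hea,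
      FontaineWeb.flow, if_pos he]
  · obtain ⟨-, hm⟩ := G.bdryArc_spec j
    obtain ⟨h1, h2⟩ := FontaineWeb.faceLabel_bdryArc hε j
    funext i
    have hne : (G.faceLabel ε (G.bdryArc j)).val ≠ (G.faceLabel ε (G.bdryArc j).swap).val :=
      fun h => FontaineWeb.faceLabel_ne hε hm (ZMod.val_injective n h)
    rw [bdryLabel, hcor _ hm, binaryLabel_edgeCoroot (ZMod.val_lt _) (ZMod.val_lt _) hne]
    have e1 : (G.faceLabel ε (G.bdryArc j)).val = partialSum n G.boundaryWeight (j.val + 1) := by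
      rw [h1, ZMod.val_natCast]
      simp only [partialSum, Nat.lt_succ_iff, Fin.le_def]
    have e2 : (G.faceLabel ε (G.bdryArc j).swap).val = partialSum n G.boundaryWeight j.val := by
      rw [h2, ZMod.val_natCast]
      simp only [partialSum, Fin.lt_def]
    rw [e1, e2]
    rfl

/-! ## Positivity -/

theorem sum_neg_q_zpow_ne_zero {ι : Type*} {s : Finset ι} (hs : s.Nonempty) (z : ι → ℤ) :
    ∑ i ∈ s, (-q) ^ z i ≠ 0 := by
  have hq : (-q : K) ≠ 0 := neg_ne_zero.2 RatFunc.X_ne_zero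
  -- Any bound on the negative exponents will do; multiplication by `(-q) ^ N` turns the sum into a
  -- polynomial.
  obtain ⟨N, hN⟩ : ∃ N : ℤ, ∀ i ∈ s, 0 ≤ z i + N := by
    refine ⟨∑ i ∈ s, |z i|, fun i hi => ?_⟩
    have := Finset.single_le_sum (f := fun i => |z i|) (fun i _ => abs_nonneg _) hi
    have := neg_abs_le (z i)
    linarith
  let P : Polynomial ℂ := ∑ i ∈ s, (-Polynomial.X) ^ (z i + N).toNat
  have hP : P ≠ 0 := by
    intro h
    -- At `-1` each power of `-X` equals one, so the value is the number of terms, which is nonzero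
    -- in characteristic zero.
    have := congrArg (Polynomial.eval (-1)) h
    simp only [P, Polynomial.eval_finsetSum, Polynomial.eval_pow, Polynomial.eval_neg,
      Polynomial.eval_X, neg_neg, one_pow, Finset.sum_const, nsmul_eq_mul, mul_one,
      Polynomial.eval_zero, Nat.cast_eq_zero, Finset.card_eq_zero] at this
    exact hs.ne_empty this
  have hmul : (∑ i ∈ s, (-q) ^ z i) * (-q) ^ N = algebraMap (Polynomial ℂ) K P := by
    rw [Finset.sum_mul, map_sum]
    refine Finset.sum_congr rfl fun i hi => ?_
    rw [map_pow, map_neg, RatFunc.algebraMap_X, ← zpow_add₀ hq]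
    conv_lhs => rw [← Int.toNat_of_nonneg (hN i hi), zpow_natCast]
    rfl
  intro h0
  rw [h0, zero_mul] at hmul
  exact hP ((map_eq_zero_iff _ (RatFunc.algebraMap_injective ℂ)).1 hmul.symm)

/-- Different strandings may share a monomial. What matters is that each contributes a pure power of
`-q`. -/
theorem repr_webVector {n m : ℕ} {k : Fin m → ℕ} (G : F n k) (T : (j : Fin m) → Idx n (k j)) :
    (monomialBasis n k).repr (webVector G) T =
      ∑ S : strandings G.1 with strandingIdx G S = T,
        (-q) ^ ((xStat G.1 S.1 : ℤ) - (yStat G.1 S.1 : ℤ)) := by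
  classical
  unfold webVector
  rw [map_sum, Finsupp.finsetSum_apply, Finset.sum_filter]
  refine Finset.sum_congr rfl fun S _ => ?_
  rw [strandingMonomial, ← monomialBasis_apply, map_smul, Module.Basis.repr_self,
    Finsupp.smul_apply, Finsupp.single_apply, smul_eq_mul, mul_ite, mul_one, mul_zero]

end Webs
end

theorem corollary5p6 (n : ℕ) (hn : 2 ≤ n) {m : ℕ} (k : Fin m → ℕ)
    (hk : ∀ j, 1 ≤ k j ∧ k j ≤ n - 1) (G : Webs.F n k) :
    Webs.webVector G ≠ 0 ∧
      (Webs.monomialBasis n k).repr (Webs.webVector G) (Webs.baseIdx n k hk) ≠ 0 := by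
  have h : (Webs.monomialBasis n k).repr (Webs.webVector G) (Webs.baseIdx n k hk) ≠ 0 := by
    obtain ⟨S, hS, hb⟩ := Webs.exists_stranding_baseLabel hn G.1
    rw [Webs.repr_webVector]
    refine Webs.sum_neg_q_zpow_ne_zero ⟨⟨S, hS⟩, Finset.mem_filter.2 ⟨Finset.mem_univ _, ?_⟩⟩ _
    funext j
    have hG : G.1.boundaryWeight = k := G.2
    exact Subtype.ext (congrArg Webs.support ((hb j).trans (by rw [hG])))
  exact ⟨fun h0 => h (by rw [h0, map_zero, Finsupp.zero_apply]), h⟩
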